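/- For $0\le\underline\sigma\le\overline\sigma<\infty$ let $G(a)=\frac12(\overline\sigma^2a^+-\underline\sigma^2a^-)$, $a\in\mathbb R$. For a bounded Lipschitz function $\varphi:\mathbb R\to\mathbb R$ (written $\varphi\in C_{b,Lip}(\mathbb R)$) let $u^{\varphi}$ be the bounded viscosity solution, continuous on $[0,\infty)\times\mathbb R$, of the $G$-heat equation $\partial_tu-G(\partial_x^2u)=0$ on $(0,\infty)\times\mathbb R$ with $u(0,\cdot)=\varphi$, and define the $G$-normal distribution by $N_G[\varphi]=u^{\varphi}(1,0)$. It is called non-degenerate if $\underline\sigma>0$, and then $\beta_G:=\overline\sigma/\underline\sigma$. The convolution is $N_{G_1}*N_{G_2}[\varphi]:=N_{G_1}\big[x\mapsto N_{G_2}[\varphi(x+\cdot)]\big]$. For $\beta\ge1$ let $\phi_\beta$ be the $2\pi$-periodic function with $$\phi_\beta(x)=\begin{cases}\frac{2}{1+\beta}\cos\big(\frac{1+\beta}{2}x\big), & x\in\big[-\frac{\pi}{1+\beta},\frac{\pi}{1+\beta}\big),\\[2pt] \frac{2\beta}{1+\beta}\cos\big(\frac{1+\beta}{2\beta}x+\frac{\beta-1}{2\beta}\pi\big),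 & x\in\big[\frac{\pi}{1+\beta},\frac{(2\beta+1)\pi}{1+\beta}\big).\end{cases}$$ **Theorem.** Let $N_{G_1}$ and $N_{G_2}$ be non-degenerate. (i) $N_{G_1}*N_{G_2}[\varphi]=N_{G_2}*N_{G_1}[\varphi]$ for all $\varphi\in C_{b,Lip}(\mathbb R)$ if and only if $\beta_{G_1}=\beta_{G_2}$. (ii) If $\beta_{G_1}\ne\beta_{G_2}$, then $N_{G_1}*N_{G_2}[\phi_{\beta_{G_1}}(\sqrt t\,\cdot)]\neq N_{G_2}*N_{G_1}[\phi_{\beta_{G_1}}(\sqrt t\,\cdot)]$ for all sufficiently large $t$. (iii) If $\beta_{G_1}<\beta_{G_2}$, then $N_{G_1}*N_{G_2}[\phi_{\beta_{G_1}}(\sqrt t\,\cdot)]> N_{G_2}*N_{G_1}[\phi_{\beta_{G_1}}(\sqrt t\,\cdot)]$ for all sufficiently large $t$. In particular, convolution of $G$-normal distributions is not commutative: there are non-degenerate $G_1,G_2$ and $\varphi\in C_{b,Lip}(\mathbb R)$ with $N_{G_1}*N_{G_2}[\varphi]\ne N_{G_2}*N_{G_1}[\varphi]$. -/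

import Mathlib

namespace GNormal

/-- The data of a function `G(a) = (σhi² a⁺ - σlo² a⁻) / 2` with `0 ≤ σlo ≤ σhi < ∞`. -/
structure GFunction where
  /-- the lower standard deviation -/
  sigmaLo : ℝ
  /-- the upper standard deviation -/
  sigmaHi : ℝ
  sigmaLo_nonneg : 0 ≤ sigmaLo
  sigmaLo_le_sigmaHi : sigmaLo ≤ sigmaHi

/-- The function `G(a) = (σhi² a⁺ - σlo² a⁻) / 2`. -/
noncomputable def GFunction.eval (G : GFunction) (a : ℝ) : ℝ :=
  1 / 2 * (G.sigmaHi ^ 2 * max a 0 - G.sigmaLo ^ 2 * max (-a) 0)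

/-- `G` (equivalently, the `G`-normal distribution) is non-degenerate if `σlo > 0`. -/
def GFunction.Nondegenerate (G : GFunction) : Prop := 0 < G.sigmaLo

/-- The ratio `β_G = σhi / σlo` (used for non-degenerate `G`). -/
noncomputable def GFunction.beta (G : GFunction) : ℝ := G.sigmaHi / G.sigmaLo

/-- The class `C_{b,Lip}(ℝ)` of bounded Lipschitz functions on `ℝ`. -/
def IsBoundedLipschitz (φ : ℝ → ℝ) : Prop :=
  (∃ C : ℝ, ∀ x, |φ x| ≤ C) ∧ ∃ K : NNReal, LipschitzWith K φ

/-- The open half-plane `(0, ∞) × ℝ` on which the equation is posed. -/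
def domain : Set (ℝ × ℝ) := Set.Ioi (0 : ℝ) ×ˢ Set.univ

/-- `u` is a viscosity subsolution of `∂ₜu - G(∂ₓ²u) = 0` on `(0, ∞) × ℝ`: whenever `ψ` is a
`C²` test function and `u - ψ` has a local maximum at `(t, x)`,
`∂ₜψ(t,x) - G(∂ₓ²ψ(t,x)) ≤ 0`. -/
def IsViscositySubsolution (G : GFunction) (u : ℝ × ℝ → ℝ) : Prop :=
  ∀ ψ : ℝ × ℝ → ℝ, ContDiffOn ℝ 2 ψ domain →
    ∀ t x : ℝ, 0 < t → IsLocalMax (fun p => u p - ψ p) (t, x) →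
      deriv (fun s => ψ (s, x)) t - G.eval (iteratedDeriv 2 (fun y => ψ (t, y)) x) ≤ 0

/-- `u` is a viscosity supersolution of `∂ₜu - G(∂ₓ²u) = 0` on `(0, ∞) × ℝ`: whenever `ψ` is a
`C²` test function and `u - ψ` has a local minimum at `(t, x)`,
`∂ₜψ(t,x) - G(∂ₓ²ψ(t,x)) ≥ 0`. -/
def IsViscositySupersolution (G : GFunction) (u : ℝ × ℝ → ℝ) : Prop :=
  ∀ ψ : ℝ × ℝ → ℝ, ContDiffOn ℝ 2 ψ domain →
    ∀ t x : ℝ, 0 < t → IsLocalMin (fun p => u p - ψ p) (t, x) →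
      0 ≤ deriv (fun s => ψ (s, x)) t - G.eval (iteratedDeriv 2 (fun y => ψ (t, y)) x)

/-- `u` is a bounded viscosity solution, continuous on `[0, ∞) × ℝ`, of the `G`-heat equation
`∂ₜu - G(∂ₓ²u) = 0` on `(0, ∞) × ℝ` with `u(0, ·) = φ`. The values of `u` at negative times
play no role. -/
structure IsViscositySolution (G : GFunction) (φ : ℝ → ℝ) (u : ℝ × ℝ → ℝ) : Prop where
  continuousOn : ContinuousOn u (Set.Ici (0 : ℝ) ×ˢ Set.univ)
  bounded : ∃ C : ℝ, ∀ t x : ℝ, 0 ≤ t → |u (t, x)| ≤ C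
  initial : ∀ x : ℝ, u (0, x) = φ x
  subsolution : IsViscositySubsolution G u
  supersolution : IsViscositySupersolution G u

open Classical in
/-- The `G`-normal distribution `N_G[φ] = u^φ(1, 0)`, where `u^φ` is the viscosity solution of the
`G`-heat equation with initial value `φ`. -/
noncomputable def gNormal (G : GFunction) (φ : ℝ → ℝ) : ℝ :=
  if h : ∃ u : ℝ × ℝ → ℝ, IsViscositySolution G φ u then h.choose (1, 0) else 0

/-- The convolution `(N_{G₁} * N_{G₂})[φ] = N_{G₁}[x ↦ N_{G₂}[φ(x + ·)]]`. -/
noncomputable def gConv (G₁ G₂ : GFunction) (φ : ℝ → ℝ) : ℝ :=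
  gNormal G₁ (fun x => gNormal G₂ (fun y => φ (x + y)))

/-- The `2π`-periodic function `φ_β` given on `[-π/(1+β), (2β+1)π/(1+β))` by
`2/(1+β) cos((1+β)x/2)` for `x < π/(1+β)` and by
`2β/(1+β) cos((1+β)x/(2β) + (β-1)π/(2β))` for `x ≥ π/(1+β)`; here `y` is the representative
of `x` modulo `2π` in that interval. -/
noncomputable def phi (β x : ℝ) : ℝ :=
  let y : ℝ := toIcoMod Real.two_pi_pos (-(Real.pi / (1 + β))) x
  if y < Real.pi / (1 + β) then
    2 / (1 + β) * Real.cos ((1 + β) / 2 * y)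
  else
    2 * β / (1 + β) * Real.cos ((1 + β) / (2 * β) * y + (β - 1) / (2 * β) * Real.pi)

end GNormal

namespace GNormal

open Filter Topology Set MeasureTheory

/-! The operator `N_G` is the time-one map of the `G`-heat flow, so everything rests on existence,
uniqueness and barriers for that equation. The flow scales parabolically (`gNormal_scaled`), hence
inserting `√t` into the test function amounts to running the inner flow up to time `t`.

If `β_{G₁} = β_{G₂}`, then `G₂ = c G₁` for some `c > 0`. Both distributions then come from a single
semigroup, at times `1` and `c`, and both convolutions equal `u(1 + c, 0)`
(`gConv_comm_of_beta_eq`).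

If the ratios differ, start from `φ = phi G₁.beta`. Since `φ''` is a negative multiple of `φ` on
each arc, `G` uses `σlo` where `φ > 0` and `σhi` where `φ < 0`; the two decay rates agree exactly
when `β = β_G`. So the `G₁`-flow multiplies `φ` by a decaying exponential and tends to zero
uniformly (`abs_le_exp_of_phi_beta`). For `G₂` the rates disagree, `exp(-μt) φ` has slack on the
negative arc, and a trigonometric perturbation turns this slack into a uniform bound: the flow is
eventually at least some `δ > 0` if `β_{G₂} > β_{G₁}`, and at most `-δ` if `β_{G₂} < β_{G₁}`
(`eventually_ge_of_lt_beta`, `eventually_le_neg_of_beta_lt`). The outer expectation preserves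
constant bounds, so the convolutions separate for large `t`.

Existence comes from ultrafilter limits of a monotone random-walk scheme
(`exists_isViscositySolution`). Uniqueness avoids doubling of variables: `G` is the maximum of two
linear functions, so a supersolution is a supersolution of two linear heat equations. Mollification
preserves those, because it commutes with random walks, and the smooth result is a classical barrier
(`moll_isSupersolution`, `comparison`). -/

/-! ### Viscosity subsolutions and jets of test functions -/

/-- `u` is a viscosity subsolution of `∂ₜu - F(∂ₓ²u) = 0` on `(0, ∞) × ℝ`, for a general `F`. -/
def IsSub (F : ℝ → ℝ) (u : ℝ × ℝ → ℝ) : Prop :=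
  ∀ ψ : ℝ × ℝ → ℝ, ContDiffOn ℝ 2 ψ domain →
    ∀ t x : ℝ, 0 < t → IsLocalMax (fun p => u p - ψ p) (t, x) →
      deriv (fun s => ψ (s, x)) t - F (iteratedDeriv 2 (fun y => ψ (t, y)) x) ≤ 0

/-- The function `a ↦ -F(-a)`, whose subsolutions are the negatives of supersolutions for `F`. -/
def dual (F : ℝ → ℝ) (a : ℝ) : ℝ := -F (-a)

/-- `ψ` is `C²` near `(t, x)` with `∂ₜψ = p` and `∂ₓ²ψ = A` at that point. -/
structure HasJet (ψ : ℝ × ℝ → ℝ) (t x p A : ℝ) : Prop where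
  contDiffAt : ContDiffAt ℝ 2 ψ (t, x)
  time : HasDerivAt (fun s => ψ (s, x)) p t
  space : ∃ d : ℝ → ℝ, (∀ᶠ y in 𝓝 x, HasDerivAt (fun y => ψ (t, y)) (d y) y) ∧ HasDerivAt d A x

theorem iteratedDeriv_two_eq {f d : ℝ → ℝ} {A x : ℝ} (h : ∀ᶠ y in 𝓝 x, HasDerivAt f (d y) y)
    (hd : HasDerivAt d A x) : iteratedDeriv 2 f x = A := by
  rw [iteratedDeriv_succ, iteratedDeriv_one]
  have : deriv f =ᶠ[𝓝 x] d := h.mono fun y hy => hy.deriv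
  rw [this.deriv_eq, hd.deriv]

theorem HasJet.of_contDiffAt {ψ : ℝ × ℝ → ℝ} {t x : ℝ} (h : ContDiffAt ℝ 2 ψ (t, x)) :
    HasJet ψ t x (deriv (fun s => ψ (s, x)) t) (iteratedDeriv 2 (fun y => ψ (t, y)) x) := by
  have hx : ContDiffAt ℝ 2 (fun y => ψ (t, y)) x :=
    ContDiffAt.comp (g := ψ) (f := fun y => (t, y)) x h (by fun_prop)
  have ht : ContDiffAt ℝ 2 (fun s => ψ (s, x)) t :=
    ContDiffAt.comp (g := ψ) (f := fun s => (s, x)) t h (by fun_prop)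
  refine ⟨h, (ht.differentiableAt (by norm_num)).hasDerivAt, deriv (fun y => ψ (t, y)), ?_, ?_⟩
  · filter_upwards [hx.eventually (by simp)] with y hy
    exact (hy.differentiableAt (by norm_num)).hasDerivAt
  · rw [iteratedDeriv_succ, iteratedDeriv_one]
    refine DifferentiableAt.hasDerivAt ?_
    exact (hx.derivWithin (m := 1) (by norm_num)).differentiableAt (by norm_num)

theorem HasJet.deriv_eq {ψ : ℝ × ℝ → ℝ} {t x p A : ℝ} (h : HasJet ψ t x p A) :
    deriv (fun s => ψ (s, x)) t = p := h.time.deriv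

theorem HasJet.iteratedDeriv_eq {ψ : ℝ × ℝ → ℝ} {t x p A : ℝ} (h : HasJet ψ t x p A) :
    iteratedDeriv 2 (fun y => ψ (t, y)) x = A := by
  obtain ⟨d, h1, h2⟩ := h.space
  exact iteratedDeriv_two_eq h1 h2

theorem HasJet.add {ψ χ : ℝ × ℝ → ℝ} {t x p A q B : ℝ} (h : HasJet ψ t x p A)
    (h' : HasJet χ t x q B) : HasJet (fun z => ψ z + χ z) t x (p + q) (A + B) := by
  obtain ⟨d, h1, h2⟩ := h.space
  obtain ⟨e, k1, k2⟩ := h'.space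
  refine ⟨h.contDiffAt.add h'.contDiffAt, h.time.add h'.time, fun y => d y + e y, ?_, h2.add k2⟩
  filter_upwards [h1, k1] with y a b using a.add b

/-- Separated test functions `a(t) f(x)`. -/
theorem HasJet.mul {a f f' : ℝ → ℝ} {t x a' A : ℝ} (ha : ContDiffAt ℝ 2 a t)
    (hf : ContDiffAt ℝ 2 f x) (ha' : HasDerivAt a a' t) (hf' : ∀ᶠ y in 𝓝 x, HasDerivAt f (f' y) y)
    (hf'' : HasDerivAt f' A x) :
    HasJet (fun z => a z.1 * f z.2) t x (a' * f x) (a t * A) := by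
  refine ⟨?_, ha'.mul_const (f x), fun y => a t * f' y, ?_, hf''.const_mul _⟩
  · exact (ContDiffAt.comp (t, x) (g := a) (f := Prod.fst) ha contDiffAt_fst).mul
      (ContDiffAt.comp (t, x) (g := f) (f := Prod.snd) hf contDiffAt_snd)
  · filter_upwards [hf'] with y hy using hy.const_mul _

theorem HasJet.of_time {a : ℝ → ℝ} {t x a' : ℝ} (ha : ContDiffAt ℝ 2 a t)
    (ha' : HasDerivAt a a' t) : HasJet (fun z => a z.1) t x a' 0 := by
  have := HasJet.mul (x := x) ha contDiffAt_const ha'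
    (Eventually.of_forall fun y => hasDerivAt_const y (1 : ℝ)) (hasDerivAt_const x (0 : ℝ))
  simpa using this

theorem HasJet.of_space {f f' : ℝ → ℝ} {t x A : ℝ}
    (hf : ContDiffAt ℝ 2 f x) (hf' : ∀ᶠ y in 𝓝 x, HasDerivAt f (f' y) y)
    (hf'' : HasDerivAt f' A x) : HasJet (fun z => f z.2) t x 0 A := by
  have := HasJet.mul (t := t) (contDiffAt_const (c := (1 : ℝ))) hf (hasDerivAt_const t (1 : ℝ))
    hf' hf''
  simpa using this

/-- Only the germ of the test function matters. -/
theorem IsSub.le_of_hasJet {F : ℝ → ℝ} {u ψ : ℝ × ℝ → ℝ} {t x p A : ℝ} (hu : IsSub F u)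
    (ht : 0 < t) (hψ : HasJet ψ t x p A) (hmax : IsLocalMax (fun z => u z - ψ z) (t, x)) :
    p ≤ F A := by
  obtain ⟨s, hs, hsψ⟩ := hψ.contDiffAt.contDiffOn (m := 2) le_rfl (by simp)
  have hs' : s ∈ 𝓝 (t, x) := by simpa using hs
  obtain ⟨r, hr, hrs⟩ := Metric.mem_nhds_iff.1 hs'
  -- The definition asks for a test function that is `C²` on the whole domain, so `ψ` is cut off
  -- near the point without changing its germ there.
  let χ : ContDiffBump ((t, x) : ℝ × ℝ) := ⟨r / 4, r / 2, by positivity, by linarith⟩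
  have hsmooth : ContDiff ℝ 2 (fun z => χ z * ψ z) := by
    rw [contDiff_iff_contDiffAt]
    intro z
    by_cases hz : z ∈ Metric.ball ((t, x) : ℝ × ℝ) r
    · refine χ.contDiffAt.mul (hsψ.contDiffAt ?_)
      exact mem_of_superset (Metric.isOpen_ball.mem_nhds hz) (hrs.trans (by simp))
    · have hz' : z ∉ tsupport χ := by
        rw [χ.tsupport_eq]
        simp only [Metric.mem_ball, Metric.mem_closedBall, not_lt, not_le] at hz ⊢
        change r / 2 < _
        linarith
      have : (fun z => χ z * ψ z) =ᶠ[𝓝 z] fun _ => 0 := by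
        filter_upwards [(isClosed_tsupport χ).isOpen_compl.mem_nhds hz'] with y hy
        rw [image_eq_zero_of_notMem_tsupport hy, zero_mul]
      exact contDiffAt_const.congr_of_eventuallyEq this
  have heq : (fun z => χ z * ψ z) =ᶠ[𝓝 (t, x)] ψ := by
    filter_upwards [χ.eventuallyEq_one] with z hz
    rw [hz]; simp
  have key := hu (fun z => χ z * ψ z) hsmooth.contDiffOn t x ht ?_
  · have h1 : (fun s => χ (s, x) * ψ (s, x)) =ᶠ[𝓝 t] fun s => ψ (s, x) :=
      (Continuous.tendsto (f := fun s : ℝ => (s, x)) (by fun_prop) t).eventually heq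
    have h2 : (fun y => χ (t, y) * ψ (t, y)) =ᶠ[𝓝 x] fun y => ψ (t, y) :=
      (Continuous.tendsto (f := fun y : ℝ => (t, y)) (by fun_prop) x).eventually heq
    rw [h1.deriv_eq, h2.iteratedDeriv_eq, hψ.deriv_eq, hψ.iteratedDeriv_eq] at key
    linarith
  · have h0 := heq.self_of_nhds
    filter_upwards [hmax, heq] with z hz hz'
    simp only at h0 hz' hz ⊢
    rw [hz', h0]; exact hz

theorem IsViscositySupersolution.isSub_dual {G : GFunction} {v : ℝ × ℝ → ℝ}
    (h : IsViscositySupersolution G v) : IsSub (dual G.eval) (fun z => -v z) := by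
  intro ψ hψ t x ht hmax
  have := h (fun z => -ψ z) hψ.neg t x ht ?_
  · have e2 := iteratedDeriv_fun_neg 2 (fun y => ψ (t, y)) x
    rw [e2, deriv.fun_neg] at this
    simp only [dual]
    linarith
  · filter_upwards [hmax] with z hz
    linarith

theorem IsSub.isViscositySupersolution {G : GFunction} {v : ℝ × ℝ → ℝ}
    (h : IsSub (dual G.eval) (fun z => -v z)) : IsViscositySupersolution G v := by
  intro ψ hψ t x ht hmin
  have := h (fun z => -ψ z) hψ.neg t x ht ?_
  · have e2 := iteratedDeriv_fun_neg 2 (fun y => ψ (t, y)) x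
    rw [e2, deriv.fun_neg] at this
    simp only [dual, neg_neg] at this
    linarith
  · filter_upwards [hmin] with z hz
    linarith

/-- Affine changes of variables. -/
theorem IsSub.comp_affine {F F' : ℝ → ℝ} {u : ℝ × ℝ → ℝ} (hu : IsSub F u) {t₀ a b x₀ : ℝ}
    (ht₀ : 0 ≤ t₀) (ha : 0 < a) (hb : 0 < b) (hF : ∀ A, F' A = a * F (A / b ^ 2)) :
    IsSub F' (fun z => u (t₀ + a * z.1, x₀ + b * z.2)) := by
  intro ψ hψ t x ht hmax
  have hdom : domain ∈ 𝓝 (t, x) :=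
    (isOpen_Ioi.prod isOpen_univ).mem_nhds ⟨ht, trivial⟩
  have hjet := HasJet.of_contDiffAt (hψ.contDiffAt hdom)
  set p := deriv (fun s => ψ (s, x)) t
  set A := iteratedDeriv 2 (fun y => ψ (t, y)) x
  let τ : ℝ → ℝ := fun s => (s - t₀) / a
  let ξ : ℝ → ℝ := fun y => (y - x₀) / b
  have hτ : τ (t₀ + a * t) = t := by simp [τ, ha.ne']
  have hξ : ξ (x₀ + b * x) = x := by simp [ξ, hb.ne']
  have dτ : ∀ s, HasDerivAt τ (1 / a) s := fun s => ((hasDerivAt_id s).sub_const _).div_const _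
  have dξ : ∀ y, HasDerivAt ξ (1 / b) y := fun y => ((hasDerivAt_id y).sub_const _).div_const _
  have hcξ : Tendsto ξ (𝓝 (x₀ + b * x)) (𝓝 x) := by
    simpa [hξ] using (dξ (x₀ + b * x)).continuousAt.tendsto
  have hj : HasJet (fun z => ψ (τ z.1, ξ z.2)) (t₀ + a * t) (x₀ + b * x) (p * (1 / a))
      (A / b ^ 2) := by
    obtain ⟨d, h1, h2⟩ := hjet.space
    refine ⟨?_, ?_, fun y => d (ξ y) * (1 / b), ?_, ?_⟩
    · refine ContDiffAt.comp (g := ψ) (f := fun z : ℝ × ℝ => (τ z.1, ξ z.2)) _ ?_ ?_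
      · simp only [hτ, hξ]; exact hjet.contDiffAt
      · simp only [τ, ξ]; fun_prop
    · have := HasDerivAt.comp (h₂ := fun s => ψ (s, x)) (t₀ + a * t) (by rw [hτ]; exact hjet.time)
        (dτ _)
      simpa [Function.comp_def, hξ] using this
    · filter_upwards [hcξ.eventually h1] with y hy
      have := HasDerivAt.comp (h₂ := fun y => ψ (t, y)) y hy (dξ y)
      simpa [Function.comp_def, hτ] using this
    · have := HasDerivAt.comp (h₂ := d) (x₀ + b * x) (by rw [hξ]; exact h2) (dξ _)
      have := this.mul_const (1 / b)
      refine this.congr_deriv ?_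
      field_simp
  have hle := hu.le_of_hasJet (t := t₀ + a * t) (by positivity) hj ?_
  · rw [hF]
    have : p * (1 / a) * a = p := by field_simp
    nlinarith [mul_le_mul_of_nonneg_right hle ha.le]
  · have hc : Tendsto (fun z : ℝ × ℝ => (τ z.1, ξ z.2)) (𝓝 (t₀ + a * t, x₀ + b * x))
        (𝓝 (t, x)) := by
      have : Continuous fun z : ℝ × ℝ => (τ z.1, ξ z.2) := by
        simp only [τ, ξ]; fun_prop
      simpa [hτ, hξ] using this.tendsto (t₀ + a * t, x₀ + b * x)
    filter_upwards [hc.eventually hmax] with z hz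
    have e1 : t₀ + a * τ z.1 = z.1 := by simp only [τ]; field_simp; ring
    have e2 : x₀ + b * ξ z.2 = z.2 := by simp only [ξ]; field_simp; ring
    simp only [e1, e2, hτ, hξ] at hz ⊢
    exact hz

/-! ### Comparison with classical supersolutions -/

/-- Degenerate ellipticity with the Lipschitz bound `Λ`. -/
structure Elliptic (F : ℝ → ℝ) (Λ : ℝ) : Prop where
  nonneg : 0 ≤ Λ
  mono : ∀ a b, 0 ≤ b → F a ≤ F (a + b)
  le : ∀ a b, 0 ≤ b → F (a + b) ≤ F a + Λ * b

theorem Elliptic.dual {F : ℝ → ℝ} {Λ : ℝ} (h : Elliptic F Λ) : Elliptic (dual F) Λ where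
  nonneg := h.nonneg
  mono a b hb := by
    have := h.mono (-(a + b)) b hb
    simp only [GNormal.dual]
    rw [show -(a + b) + b = -a by ring] at this
    linarith
  le a b hb := by
    have := h.le (-(a + b)) b hb
    simp only [GNormal.dual]
    rw [show -(a + b) + b = -a by ring] at this
    linarith

/-- Comparison of a viscosity subsolution with a classical supersolution that is bounded below. -/
theorem IsSub.le_classical {F : ℝ → ℝ} {Λ T C : ℝ} {u ψ : ℝ × ℝ → ℝ} (hF : Elliptic F Λ)
    (hu : IsSub F u) (huc : ContinuousOn u (Ici (0 : ℝ) ×ˢ univ))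
    (hub : ∀ t x, 0 ≤ t → u (t, x) ≤ C)
    (hψc : ContinuousOn ψ (Ico 0 T ×ˢ univ)) (hψb : ∀ t x, 0 ≤ t → t < T → -C ≤ ψ (t, x))
    (hjet : ∀ t x, 0 < t → t < T → ∃ p A, HasJet ψ t x p A ∧ F A ≤ p)
    (h0 : ∀ x, u (0, x) ≤ ψ (0, x)) {t x : ℝ} (ht : 0 ≤ t) (htT : t < T) :
    u (t, x) ≤ ψ (t, x) := by
  have hΛ := hF.nonneg
  suffices H : ∀ α > 0, u (t, x) ≤ ψ (t, x) + α * (x ^ 2 + (2 * Λ + 1) * t + 1 / (T - t)) by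
    have hl : Tendsto (fun α : ℝ => ψ (t, x) + α * (x ^ 2 + (2 * Λ + 1) * t + 1 / (T - t)))
        (𝓝[>] 0) (𝓝 (ψ (t, x) + 0 * (x ^ 2 + (2 * Λ + 1) * t + 1 / (T - t)))) :=
      ((Continuous.tendsto (by fun_prop) 0).mono_left nhdsWithin_le_nhds)
    refine (ge_of_tendsto hl (?_)).trans (by simp)
    filter_upwards [self_mem_nhdsWithin] with α hα using H α hα
  intro α hα
  by_contra! hlt
  -- The term `α x²` confines the maximum in space and `α / (T - t)` keeps it away from `T`. By
  -- ellipticity the former costs at most `2Λα`, which the slope `(2Λ + 1)α` in time more than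
  -- repays; this gives strictness.
  let P : ℝ × ℝ → ℝ := fun z => ψ z + α * (z.2 ^ 2 + (2 * Λ + 1) * z.1 + 1 / (T - z.1))
  let w : ℝ × ℝ → ℝ := fun z => u z - P z
  have hT : 0 < T := ht.trans_lt htT
  have hC : 0 ≤ 2 * |C| + 1 := by positivity
  -- outside a compact set `w` is negative
  let R := Real.sqrt ((2 * |C| + 1) / α)
  let T' := T - α / (2 * |C| + 1)
  have hwneg : ∀ s y, 0 ≤ s → s < T → 0 < w (s, y) → s ≤ T' ∧ |y| ≤ R := by
    intro s y hs hsT hw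
    have hw' : ψ (s, y) + α * (y ^ 2 + (2 * Λ + 1) * s + 1 / (T - s)) < u (s, y) := by
      simpa [w, P] using hw
    have b1 := hub s y hs
    have b2 := hψb s y hs hsT
    have b3 := le_abs_self C
    have hTs : 0 < T - s := by linarith
    have p1 : 0 ≤ α * y ^ 2 := by positivity
    have p2 : 0 ≤ α * ((2 * Λ + 1) * s) := by positivity
    have p3 : 0 ≤ α * (1 / (T - s)) := by positivity
    have b4 : α * (y ^ 2 + (2 * Λ + 1) * s + 1 / (T - s)) < 2 * |C| + 1 := by linarith
    constructor
    · have : α * (1 / (T - s)) ≤ 2 * |C| + 1 := by nlinarith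
      rw [mul_one_div, div_le_iff₀ hTs] at this
      have : α / (2 * |C| + 1) ≤ T - s := by
        rw [div_le_iff₀ (by positivity)]; linarith
      simp only [T']; linarith
    · apply Real.abs_le_sqrt
      rw [le_div_iff₀ hα]
      nlinarith
  let K : Set (ℝ × ℝ) := Icc 0 T' ×ˢ Icc (-R) R
  have hT'T : T' < T := by
    have : 0 < α / (2 * |C| + 1) := by positivity
    simp only [T']; linarith
  have hKc : IsCompact K := isCompact_Icc.prod isCompact_Icc
  have hwc : ContinuousOn w (Ico 0 T ×ˢ univ) := by
    refine (huc.mono (prod_mono Ico_subset_Ici_self le_rfl)).sub (hψc.add ?_)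
    refine continuousOn_const.mul (ContinuousOn.add (by fun_prop) ?_)
    refine ContinuousOn.div continuousOn_const (by fun_prop) ?_
    rintro ⟨s, y⟩ ⟨hs, -⟩
    exact (sub_pos.2 hs.2).ne'
  have hmem : ∀ s y, 0 ≤ s → s < T → 0 < w (s, y) → (s, y) ∈ K := by
    intro s y hs hsT hw
    obtain ⟨h1, h2⟩ := hwneg s y hs hsT hw
    exact ⟨⟨hs, h1⟩, abs_le.1 h2⟩
  have hwt : 0 < w (t, x) := by simpa [w, P] using hlt
  obtain ⟨⟨s, y⟩, hsyK, hsy⟩ := hKc.exists_isMaxOn ⟨(t, x), hmem t x ht htT hwt⟩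
    (hwc.mono (prod_mono (fun s hs => ⟨hs.1, hs.2.trans_lt hT'T⟩) (subset_univ _)))
  have hpos : 0 < w (s, y) := hwt.trans_le (hsy (hmem t x ht htT hwt))
  have hsT : s < T := hsyK.1.2.trans_lt hT'T
  have hs0 : 0 < s := by
    rcases hsyK.1.1.eq_or_lt with h | h
    · exfalso
      have h : s = 0 := h.symm
      subst h
      have := h0 y
      have h2 : 0 ≤ α * (y ^ 2 + (2 * Λ + 1) * 0 + 1 / (T - 0)) := by
        have : 0 < T - 0 := by linarith
        positivity
      simp only [w, P] at hpos
      linarith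
    · exact h
  have hlocal : IsLocalMax (fun z => u z - P z) (s, y) := by
    have : Ioo 0 T ×ˢ univ ∈ 𝓝 (s, y) := (isOpen_Ioo.prod isOpen_univ).mem_nhds ⟨⟨hs0, hsT⟩, trivial⟩
    filter_upwards [this] with z hz
    change w z ≤ w (s, y)
    by_cases hz' : 0 < w z
    · exact hsy (hmem z.1 z.2 hz.1.1.le hz.1.2 hz')
    · exact (not_lt.1 hz').trans hpos.le
  obtain ⟨p, A, hj, hpA⟩ := hjet s y hs0 hsT
  have hTs : T - s ≠ 0 := (sub_pos.2 hsT).ne'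
  have j1 : HasJet (fun z => α * z.2 ^ 2) s y 0 (2 * α) := by
    refine HasJet.of_space (f := fun y => α * y ^ 2) (f' := fun y => α * (2 * y)) (by fun_prop)
      (Eventually.of_forall fun z => ?_) ?_
    · simpa using (hasDerivAt_pow 2 z).const_mul α
    · have := ((hasDerivAt_id y).const_mul 2).const_mul α
      exact this.congr_deriv (by ring)
  have j2 : HasJet (fun z => α * ((2 * Λ + 1) * z.1 + 1 / (T - z.1))) s y
      (α * ((2 * Λ + 1) + 1 / (T - s) ^ 2)) 0 := by
    refine HasJet.of_time (a := fun r => α * ((2 * Λ + 1) * r + 1 / (T - r))) ?_ ?_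
    · refine contDiffAt_const.mul (ContDiffAt.add (by fun_prop) ?_)
      exact contDiffAt_const.div (by fun_prop) hTs
    · refine HasDerivAt.const_mul _ (HasDerivAt.add ?_ ?_)
      · simpa using (hasDerivAt_id s).const_mul (2 * Λ + 1)
      · have := ((hasDerivAt_id s).const_sub T).inv hTs
        simp only [one_div]
        refine this.congr_deriv ?_
        simp
  have jP : HasJet P s y (p + (0 + α * ((2 * Λ + 1) + 1 / (T - s) ^ 2))) (A + (2 * α + 0)) := by
    have := hj.add (j1.add j2)
    convert this using 2
    simp only [P]; ring
  have hle := hu.le_of_hasJet hs0 jP hlocal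
  have := hF.le A (2 * α) (by positivity)
  rw [add_zero] at hle
  have h3 : 0 < α * (1 / (T - s) ^ 2) := by positivity
  nlinarith

/-! ### Taylor expansions, quartic barriers and the random-walk scheme -/

/-- Strict differentiability at the point controls time increments uniformly over nearby `x + z`,
and the mean value inequality handles the spatial increment at the fixed time `t`; no mixed
derivative is needed. -/
theorem HasJet.taylor {ψ : ℝ × ℝ → ℝ} {t x p A : ℝ} (h : HasJet ψ t x p A) {ε : ℝ} (hε : 0 < ε) :
    ∃ q : ℝ, ∃ r > 0, ∀ s z : ℝ, |s| < r → |z| < r →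
      |ψ (t + s, x + z) - (ψ (t, x) + p * s + q * z + A / 2 * z ^ 2)| ≤ ε * (|s| + z ^ 2) := by
  obtain ⟨d, hd, hd'⟩ := h.space
  have hst := (h.contDiffAt.hasStrictFDerivAt (by norm_num)).isLittleO.def hε
  have hD : fderiv ℝ ψ (t, x) (1, 0) = p := by
    have h1 : HasDerivAt (fun s : ℝ => (s, x)) ((1 : ℝ), (0 : ℝ)) t :=
      (hasDerivAt_id t).prodMk (hasDerivAt_const t x)
    have h2 := (h.contDiffAt.differentiableAt (by norm_num)).hasFDerivAt.comp_hasDerivAt t h1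
    exact h2.unique h.time
  obtain ⟨r₁, hr₁, h₁⟩ := Metric.eventually_nhds_iff.1 hst
  have hd'' := (hasDerivAt_iff_isLittleO.1 hd').def hε
  obtain ⟨r₂, hr₂, h₂⟩ := Metric.eventually_nhds_iff.1 (hd.and hd'')
  refine ⟨d x, min r₁ r₂, lt_min hr₁ hr₂, fun s z hs hz => ?_⟩
  have htime : |ψ (t + s, x + z) - ψ (t, x + z) - p * s| ≤ ε * |s| := by
    have := h₁ (y := ((t + s, x + z), (t, x + z))) (by
      simp only [Prod.dist_eq, Real.dist_eq, add_sub_cancel_left, sub_self, abs_zero, max_lt_iff]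
      exact ⟨⟨hs.trans_le (min_le_left _ _), hz.trans_le (min_le_left _ _)⟩, hr₁,
        hz.trans_le (min_le_left _ _)⟩)
    have e : ((t + s, x + z) : ℝ × ℝ) - (t, x + z) = s • ((1 : ℝ), (0 : ℝ)) := by simp
    simp only [e, map_smul, hD, smul_eq_mul, norm_smul, Prod.norm_mk, Real.norm_eq_abs] at this
    simpa [mul_comm s p] using this
  have hspace : |ψ (t, x + z) - ψ (t, x) - d x * z - A / 2 * z ^ 2| ≤ ε * z ^ 2 := by
    have hder : ∀ y ∈ Icc (-|z|) |z|, HasDerivWithinAt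
        (fun y => ψ (t, x + y) - d x * y - A / 2 * y ^ 2) (d (x + y) - d x - A * y)
        (Icc (-|z|) |z|) y := by
      intro y hy
      have hy' := (h₂ (y := x + y) (by
        rw [Real.dist_eq, add_sub_cancel_left]
        exact (abs_le.2 hy).trans_lt (hz.trans_le (min_le_right _ _)))).1
      have h3 : HasDerivAt (fun y => ψ (t, x + y)) (d (x + y)) y := hy'.comp_const_add x y
      have h4 := (h3.sub ((hasDerivAt_id y).const_mul (d x))).sub
        ((hasDerivAt_pow 2 y).const_mul (A / 2))
      refine (h4.congr_deriv ?_).hasDerivWithinAt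
      simp; ring
    have hbound : ∀ y ∈ Icc (-|z|) |z|, ‖d (x + y) - d x - A * y‖ ≤ ε * |z| := by
      intro y hy
      have hy' := (h₂ (y := x + y) (by
        rw [Real.dist_eq, add_sub_cancel_left]
        exact (abs_le.2 hy).trans_lt (hz.trans_le (min_le_right _ _)))).2
      simp only [add_sub_cancel_left, smul_eq_mul] at hy'
      rw [mul_comm A y]
      exact hy'.trans (mul_le_mul_of_nonneg_left (abs_le.2 hy) hε.le)
    have := (convex_Icc (-|z|) |z|).norm_image_sub_le_of_norm_hasDerivWithin_le hder hbound
      (x := 0) (y := z) ⟨by simp, by simp⟩ ⟨neg_abs_le z, le_abs_self z⟩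
    rw [sub_zero, Real.norm_eq_abs, Real.norm_eq_abs, mul_assoc, ← sq, sq_abs] at this
    refine le_trans (le_of_eq ?_) this
    congr 1
    simp; ring
  have := abs_add_le (ψ (t + s, x + z) - ψ (t, x + z) - p * s)
    (ψ (t, x + z) - ψ (t, x) - d x * z - A / 2 * z ^ 2)
  calc _ = |(ψ (t + s, x + z) - ψ (t, x + z) - p * s) +
      (ψ (t, x + z) - ψ (t, x) - d x * z - A / 2 * z ^ 2)| := by congr 1; ring
    _ ≤ _ := by linarith

/-- The polynomial `c + p(y - x₀) + a/2 (y - x₀)² + K(y - x₀)⁴`. -/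
noncomputable def quartic (c p a K x₀ y : ℝ) : ℝ :=
  c + p * (y - x₀) + a / 2 * (y - x₀) ^ 2 + K * (y - x₀) ^ 4

/-- The quartic term turns a local touching inequality into a global one: away from the contact
point it beats any bounded function, with one `K` for all `c ≥ c₀`. A nonlocal scheme needs such a
global inequality. -/
theorem exists_le_quartic (c₀ p a C : ℝ) {r : ℝ} (hr : 0 < r) :
    ∃ K, 0 ≤ K ∧ ∀ c x₀ y, c₀ ≤ c → r ≤ |y - x₀| → C ≤ quartic c p a K x₀ y := by
  refine ⟨(|C| + |c₀|) / r ^ 4 + |p| / r ^ 3 + |a| / (2 * r ^ 2), by positivity, ?_⟩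
  intro c x₀ y hc hy
  set z := y - x₀
  have hz : 0 < |z| := hr.trans_le hy
  have e4 : |z| ^ 4 = z ^ 4 := by rw [← abs_pow, abs_of_nonneg (by positivity)]
  have e2 : |z| ^ 2 = z ^ 2 := sq_abs z
  have q1 : 1 ≤ (|z| / r) := by rwa [one_le_div hr]
  have k1 : (|C| + |c₀|) ≤ (|C| + |c₀|) / r ^ 4 * z ^ 4 := by
    have : (|C| + |c₀|) / r ^ 4 * z ^ 4 = (|C| + |c₀|) * (|z| / r) ^ 4 := by
      rw [← e4]; field_simp
    rw [this]
    exact le_mul_of_one_le_right (by positivity) (one_le_pow₀ q1)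
  have k2 : |p * z| ≤ |p| / r ^ 3 * z ^ 4 := by
    have : |p| / r ^ 3 * z ^ 4 = |p * z| * (|z| / r) ^ 3 := by
      rw [← e4, abs_mul]; field_simp
    rw [this]
    exact le_mul_of_one_le_right (by positivity) (one_le_pow₀ q1)
  have k3 : |a / 2 * z ^ 2| ≤ |a| / (2 * r ^ 2) * z ^ 4 := by
    have : |a| / (2 * r ^ 2) * z ^ 4 = |a / 2 * z ^ 2| * (|z| / r) ^ 2 := by
      rw [← e4, abs_mul, abs_div, abs_two, abs_of_nonneg (by positivity : (0 : ℝ) ≤ z ^ 2), ← e2]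
      field_simp
    rw [this]
    exact le_mul_of_one_le_right (by positivity) (one_le_pow₀ q1)
  have := le_abs_self C
  have := neg_abs_le c₀
  have := neg_abs_le (p * z)
  have := neg_abs_le (a / 2 * z ^ 2)
  simp only [quartic]
  change C ≤ c + p * z + a / 2 * z ^ 2 + _ * z ^ 4
  rw [add_mul, add_mul]
  linarith

/-- Averaging over one step of the symmetric random walk of variance `σ² h`. -/
noncomputable def walk (σ h : ℝ) (f : ℝ → ℝ) (x : ℝ) : ℝ :=
  (f (x + σ * √h) + f (x - σ * √h)) / 2

/-- One step of the monotone approximation scheme for the `G`-heat equation. -/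
noncomputable def step (G : GFunction) (h : ℝ) (f : ℝ → ℝ) (x : ℝ) : ℝ :=
  max (walk G.sigmaLo h f x) (walk G.sigmaHi h f x)

theorem walk_mono {σ h : ℝ} {f g : ℝ → ℝ} (hfg : ∀ x, f x ≤ g x) (x : ℝ) :
    walk σ h f x ≤ walk σ h g x := by
  simp only [walk]; linarith [hfg (x + σ * √h), hfg (x - σ * √h)]

theorem step_mono {G : GFunction} {h : ℝ} {f g : ℝ → ℝ} (hfg : ∀ x, f x ≤ g x) (x : ℝ) :
    step G h f x ≤ step G h g x :=
  max_le_max (walk_mono hfg x) (walk_mono hfg x)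

/-- Odd moments of the symmetric step vanish, so this family of quartics is stable under the walk
and only `c` and `a` move. -/
theorem walk_quartic {σ h c p a K x₀ : ℝ} (hh : 0 ≤ h) (y : ℝ) :
    walk σ h (quartic c p a K x₀) y =
      quartic (c + σ ^ 2 / 2 * h * a + K * σ ^ 4 * h ^ 2) p (a + 12 * K * σ ^ 2 * h) K x₀ y := by
  have e := Real.sq_sqrt hh
  simp only [walk, quartic]
  generalize √h = w at *
  subst e
  ring

theorem GFunction.eval_eq_max (G : GFunction) (a : ℝ) :
    G.eval a = max (G.sigmaLo ^ 2 / 2 * a) (G.sigmaHi ^ 2 / 2 * a) := by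
  have h1 : G.sigmaLo ^ 2 ≤ G.sigmaHi ^ 2 := pow_le_pow_left₀ G.sigmaLo_nonneg G.sigmaLo_le_sigmaHi 2
  unfold GFunction.eval
  rcases le_total 0 a with ha | ha
  · rw [max_eq_left ha, max_eq_right (by linarith : -a ≤ 0), max_eq_right (by nlinarith)]; ring
  · rw [max_eq_right ha, max_eq_left (by linarith : 0 ≤ -a), max_eq_left (by nlinarith)]; ring

theorem GFunction.sq_le (G : GFunction) : G.sigmaLo ^ 2 ≤ G.sigmaHi ^ 2 :=
  pow_le_pow_left₀ G.sigmaLo_nonneg G.sigmaLo_le_sigmaHi 2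

theorem GFunction.elliptic (G : GFunction) : Elliptic G.eval (G.sigmaHi ^ 2 / 2) where
  nonneg := by positivity
  mono a b hb := by
    rw [G.eval_eq_max, G.eval_eq_max]
    apply max_le_max <;> nlinarith [sq_nonneg G.sigmaLo, sq_nonneg G.sigmaHi, mul_nonneg (sq_nonneg G.sigmaLo) hb,
      mul_nonneg (sq_nonneg G.sigmaHi) hb]
  le a b hb := by
    have h2 := mul_le_mul_of_nonneg_right G.sq_le hb
    rw [G.eval_eq_max, G.eval_eq_max, ← max_add_add_right]
    apply max_le_max <;> nlinarith

/-- The curvature drifts by `O(K k h)`, hence `c` grows by `k h G(a)` plus a quadratic error. The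
constant 3 works because one step adds at most `6 s h + h²` in units of `K σhi⁴`, while `3 ((s + h)²
- s²) = 6 s h + 3 h²`. -/
theorem step_iterate_le {G : GFunction} {h c p a K x₀ : ℝ} {f : ℝ → ℝ} (hh : 0 ≤ h) (hK : 0 ≤ K)
    (hf : ∀ y, f y ≤ quartic c p a K x₀ y) (k : ℕ) (y : ℝ) :
    (step G h)^[k] f y ≤ quartic (c + k * h * G.eval a + 3 * K * G.sigmaHi ^ 4 * (k * h) ^ 2) p
      (a + 12 * K * G.sigmaHi ^ 2 * (k * h)) K x₀ y := by
  induction k generalizing y with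
  | zero => simpa using hf y
  | succ k ih =>
    rw [Function.iterate_succ_apply']
    set s : ℝ := k * h
    have hs : 0 ≤ s := by positivity
    refine (step_mono ih y).trans ?_
    have hG := G.elliptic.le a (12 * K * G.sigmaHi ^ 2 * s) (by positivity)
    set a' := a + 12 * K * G.sigmaHi ^ 2 * s
    have hm := G.eval_eq_max a'
    have hl : G.sigmaLo ^ 2 / 2 * a' ≤ G.eval a' := hm ▸ le_max_left _ _
    have hr : G.sigmaHi ^ 2 / 2 * a' ≤ G.eval a' := hm ▸ le_max_right _ _
    have hsq := G.sq_le
    have h4 : G.sigmaLo ^ 4 ≤ G.sigmaHi ^ 4 :=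
      pow_le_pow_left₀ G.sigmaLo_nonneg G.sigmaLo_le_sigmaHi 4
    have h4' := mul_le_mul_of_nonneg_left h4 (by positivity : 0 ≤ K * h ^ 2)
    have h5 : 0 ≤ K * h ^ 2 * G.sigmaHi ^ 4 := by positivity
    have hz : 0 ≤ (y - x₀) ^ 2 := by positivity
    have hq := mul_le_mul_of_nonneg_left hsq (by positivity : 0 ≤ 6 * K * h * (y - x₀) ^ 2)
    have hG' := mul_le_mul_of_nonneg_left hG hh
    have hl' := mul_le_mul_of_nonneg_left hl hh
    have hr' := mul_le_mul_of_nonneg_left hr hh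
    refine max_le ?_ ?_ <;> rw [walk_quartic hh] <;> simp only [quartic] <;> push_cast <;>
      rw [show ((k : ℝ) + 1) * h = s + h by simp only [s]; ring] <;> simp only [a'] at * <;> nlinarith

theorem le_step_iterate {G : GFunction} {h c p a K x₀ : ℝ} {f : ℝ → ℝ} (hh : 0 ≤ h) (hK : 0 ≤ K)
    (hf : ∀ y, quartic c p a (-K) x₀ y ≤ f y) (k : ℕ) (y : ℝ) :
    quartic (c + k * h * G.eval a - 3 * K * G.sigmaHi ^ 4 * (k * h) ^ 2) p
      (a - 12 * K * G.sigmaHi ^ 2 * (k * h)) (-K) x₀ y ≤ (step G h)^[k] f y := by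
  induction k generalizing y with
  | zero => simpa using hf y
  | succ k ih =>
    rw [Function.iterate_succ_apply']
    set s : ℝ := k * h
    have hs : 0 ≤ s := by positivity
    refine le_trans ?_ (step_mono ih y)
    have hG := G.elliptic.le (a - 12 * K * G.sigmaHi ^ 2 * s) (12 * K * G.sigmaHi ^ 2 * s)
      (by positivity)
    rw [sub_add_cancel] at hG
    set a' := a - 12 * K * G.sigmaHi ^ 2 * s
    have hm := G.eval_eq_max a'
    have hsq := G.sq_le
    have h4 : G.sigmaLo ^ 4 ≤ G.sigmaHi ^ 4 :=
      pow_le_pow_left₀ G.sigmaLo_nonneg G.sigmaLo_le_sigmaHi 4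
    have h4' := mul_le_mul_of_nonneg_left h4 (by positivity : 0 ≤ K * h ^ 2)
    have h5 : 0 ≤ K * h ^ 2 * G.sigmaHi ^ 4 := by positivity
    have hz : 0 ≤ (y - x₀) ^ 2 := by positivity
    have hq := mul_le_mul_of_nonneg_left hsq (by positivity : 0 ≤ 6 * K * h * (y - x₀) ^ 2)
    have hG' := mul_le_mul_of_nonneg_left hG hh
    -- For the lower bound it suffices to follow the branch of `step` whose variance attains `G.eval
    -- a'`.
    rcases max_choice (G.sigmaLo ^ 2 / 2 * a') (G.sigmaHi ^ 2 / 2 * a') with hc | hc <;>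
      rw [hc] at hm <;> rw [hm] at hG'
    · refine le_trans ?_ (le_max_left _ _)
      rw [walk_quartic hh]; simp only [quartic]; push_cast
      rw [show ((k : ℝ) + 1) * h = s + h by simp only [s]; ring]; simp only [a'] at *; nlinarith
    · refine le_trans ?_ (le_max_right _ _)
      rw [walk_quartic hh]; simp only [quartic]; push_cast
      rw [show ((k : ℝ) + 1) * h = s + h by simp only [s]; ring]; simp only [a'] at *; nlinarith

theorem quartic_self (c p a K x₀ : ℝ) : quartic c p a K x₀ x₀ = c := by simp [quartic]

theorem abs_step_iterate_le {G : GFunction} {h C : ℝ} {f : ℝ → ℝ} (hf : ∀ x, |f x| ≤ C) (k : ℕ)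
    (x : ℝ) : |(step G h)^[k] f x| ≤ C := by
  induction k generalizing x with
  | zero => exact hf x
  | succ k ih =>
    rw [Function.iterate_succ_apply']
    set g := (step G h)^[k] f
    have hw : ∀ σ, |walk σ h g x| ≤ C := fun σ => by
      have h1 := abs_le.1 (ih (x + σ * √h))
      have h2 := abs_le.1 (ih (x - σ * √h))
      rw [abs_le]; simp only [walk]; constructor <;> linarith
    exact abs_max_le_max_abs_abs.trans (max_le (hw _) (hw _))

theorem step_iterate_lipschitz {G : GFunction} {h L : ℝ} {f : ℝ → ℝ}
    (hf : ∀ x y, f x - f y ≤ L * |x - y|) (k : ℕ) (x y : ℝ) :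
    (step G h)^[k] f x - (step G h)^[k] f y ≤ L * |x - y| := by
  induction k generalizing x y with
  | zero => exact hf x y
  | succ k ih =>
    simp only [Function.iterate_succ_apply']
    set g := (step G h)^[k] f
    have hw : ∀ σ, walk σ h g x ≤ walk σ h g y + L * |x - y| := fun σ => by
      have h1 := ih (x + σ * √h) (y + σ * √h)
      have h2 := ih (x - σ * √h) (y - σ * √h)
      rw [add_sub_add_right_eq_sub] at h1
      rw [sub_sub_sub_cancel_right] at h2
      simp only [walk]; linarith
    rw [sub_le_iff_le_add']
    exact max_le ((hw _).trans (by gcongr; exact le_max_left _ _))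
      ((hw _).trans (by gcongr; exact le_max_right _ _))

/-! ### Convergence of the scheme and existence of solutions -/

/-- Equi-Lipschitz functions that converge on a finite `ρ`-net of a compact set are controlled on
all of it, which upgrades pointwise limits to the one-sided uniform bound used below. -/
theorem eventually_le_add_of_lipschitz {ι : Type*} {l : Filter ι} {g : ι → ℝ → ℝ} {g₀ : ℝ → ℝ}
    {L : ℝ} [l.NeBot] (hL : ∀ n x y, g n x - g n y ≤ L * |x - y|)
    (hg : ∀ x, Tendsto (fun n => g n x) l (𝓝 (g₀ x))) {S : Set ℝ} (hS : IsCompact S) {δ : ℝ}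
    (hδ : 0 < δ) : ∀ᶠ n in l, ∀ x ∈ S, g n x ≤ g₀ x + δ := by
  have hL0 : ∀ x y, g₀ x - g₀ y ≤ L * |x - y| := fun x y =>
    le_of_tendsto ((hg x).sub (hg y)) (Eventually.of_forall fun n => hL n x y)
  have hL1 : 0 ≤ L := by
    have h1 := hL0 0 1
    have h2 := hL0 1 0
    simp at h1 h2; linarith
  let ρ := δ / (3 * (L + 1))
  have hρ : 0 < ρ := by positivity
  obtain ⟨T, -, hT⟩ := hS.elim_nhds_subcover (fun y => Metric.ball y ρ)
    fun y _ => Metric.ball_mem_nhds y hρ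
  have hfin : ∀ᶠ n in l, ∀ y ∈ T, g n y < g₀ y + δ / 3 :=
    (Finset.eventually_all T).2 fun y _ => (hg y).eventually (gt_mem_nhds (by linarith))
  filter_upwards [hfin] with n hn x hx
  obtain ⟨y, hy, hxy⟩ := mem_iUnion₂.1 (hT hx)
  have hd : |x - y| < ρ := hxy
  have h1 := hL n x y
  have h2 := hL0 y x
  rw [abs_sub_comm] at h2
  have h3 : L * |x - y| ≤ δ / 3 := by
    have : L * |x - y| ≤ (L + 1) * ρ := by gcongr; linarith
    have e : (L + 1) * ρ = δ / 3 := by simp only [ρ]; field_simp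
    linarith
  linarith [hn y hy]

/-- Convergence of a monotone consistent scheme to a viscosity subsolution. -/
theorem isSub_of_scheme {ι : Type*} {l : Filter ι} [l.NeBot] {F : ℝ → ℝ} {Λ C L B : ℝ}
    (hF : Elliptic F Λ) {un : ι → ℝ → ℝ → ℝ} {u : ℝ × ℝ → ℝ} {θ : ι → ℝ → ℝ → ℝ}
    (hC : ∀ n t x, un n t x ≤ C) (hL : ∀ n t x y, un n t x - un n t y ≤ L * |x - y|)
    (hu : ∀ t x, 0 ≤ t → Tendsto (fun n => un n t x) l (𝓝 (u (t, x))))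
    (hstep : ∀ n s t x₀ c p a K, 0 ≤ s → s ≤ t → 0 ≤ K →
      (∀ y, un n s y ≤ quartic c p a K x₀ y) →
      un n t x₀ ≤ c + θ n s t * F a + B * K * (θ n s t) ^ 2)
    (hθ : ∀ s t, 0 ≤ s → s ≤ t → Tendsto (fun n => θ n s t) l (𝓝 (t - s))) : IsSub F u := by
  intro ψ hψ t x ht hmax
  have hdom : domain ∈ 𝓝 (t, x) := (isOpen_Ioi.prod isOpen_univ).mem_nhds ⟨ht, trivial⟩
  have hj := HasJet.of_contDiffAt (hψ.contDiffAt hdom)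
  set p := deriv (fun s => ψ (s, x)) t
  set A := iteratedDeriv 2 (fun y => ψ (t, y)) x
  have key : ∀ ε > 0, p ≤ ε + F (A + 2 * ε) := by
    intro ε hε
    obtain ⟨q, r₁, hr₁, htay⟩ := hj.taylor hε
    obtain ⟨r₂, hr₂, hball⟩ := Metric.mem_nhds_iff.1 hmax
    let r := min (min r₁ r₂) t
    have hr : 0 < r := lt_min (lt_min hr₁ hr₂) ht
    have hrr₁ : r ≤ r₁ := (min_le_left _ _).trans (min_le_left _ _)
    have hrr₂ : r ≤ r₂ := (min_le_left _ _).trans (min_le_right _ _)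
    have hrt : r ≤ t := min_le_right _ _
    -- `K` is fixed before `s`, so the error `B K s²` is negligible after division by `s`.
    obtain ⟨K, hK, hquart⟩ := exists_le_quartic (u (t, x) - |p| * r) q (A + 2 * ε) C hr
    have hs : ∀ s, 0 < s → s < r → p ≤ ε + F (A + 2 * ε) + B * K * s := by
      intro s hs hsr
      let c := u (t, x) - p * s + ε * s
      have hc : u (t, x) - |p| * r ≤ c := by
        have : p * s ≤ |p| * r := mul_le_mul (le_abs_self p) hsr.le hs.le (abs_nonneg p)
        have : 0 < ε * s := by positivity
        simp only [c]; linarith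
      have hnear : ∀ y, |y - x| < r → u (t - s, y) ≤ quartic c q (A + 2 * ε) K x y := by
        intro y hy
        have h1 := htay (-s) (y - x) (by rw [abs_neg, abs_of_pos hs]; linarith) (by linarith)
        have h2 : (t - s, y) ∈ Metric.ball (t, x) r₂ := by
          rw [Metric.mem_ball, Prod.dist_eq, max_lt_iff, Real.dist_eq, Real.dist_eq]
          refine ⟨?_, by simp only; linarith⟩
          simp only [sub_sub_cancel_left, abs_neg, abs_of_pos hs]; linarith
        have h3 : u (t - s, y) - ψ (t - s, y) ≤ u (t, x) - ψ (t, x) := hball h2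
        rw [← sub_eq_add_neg, add_sub_cancel, abs_neg, abs_of_pos hs] at h1
        have h4 := (abs_le.1 h1).2
        have h5 : 0 ≤ K * (y - x) ^ 4 := by positivity
        simp only [quartic, c]
        nlinarith
      have hδ : ∀ δ > 0, u (t, x) ≤ c + s * F (A + 2 * ε) + B * K * s ^ 2 + δ := by
        intro δ hδ
        have hts : 0 ≤ t - s := by linarith
        have hev := eventually_le_add_of_lipschitz (g := fun n y => un n (t - s) y)
          (g₀ := fun y => u (t - s, y)) (fun n x y => hL n (t - s) x y)
          (fun y => hu (t - s) y hts) (isCompact_closedBall x r) hδ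
        have hθ' := hθ (t - s) t hts (by linarith)
        rw [sub_sub_cancel] at hθ'
        have hlim : Tendsto (fun n => (c + δ) + θ n (t - s) t * F (A + 2 * ε)
            + B * K * (θ n (t - s) t) ^ 2) l
            (𝓝 ((c + δ) + s * F (A + 2 * ε) + B * K * s ^ 2)) :=
          (tendsto_const_nhds.add (hθ'.mul_const _)).add ((hθ'.pow 2).const_mul _)
        have := le_of_tendsto_of_tendsto (hu t x ht.le) hlim ?_
        · linarith
        · filter_upwards [hev] with n hn
          refine hstep n (t - s) t x (c + δ) q (A + 2 * ε) K hts (by linarith) hK fun y => ?_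
          rcases lt_or_ge |y - x| r with hy | hy
          · have h1 := hn y (by rw [Metric.mem_closedBall, Real.dist_eq]; exact hy.le)
            have h2 := hnear y hy
            simp only [quartic] at h2 ⊢
            linarith
          · have h1 := hquart (c + δ) x y (by linarith) hy
            exact (hC n _ y).trans h1
      have h6 : u (t, x) ≤ c + s * F (A + 2 * ε) + B * K * s ^ 2 := le_of_forall_pos_le_add hδ
      have h7 : s * p ≤ s * (ε + F (A + 2 * ε) + B * K * s) := by
        simp only [c] at h6; nlinarith
      exact le_of_mul_le_mul_left h7 hs
    have hlim : Tendsto (fun s : ℝ => ε + F (A + 2 * ε) + B * K * s) (𝓝[>] 0)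
        (𝓝 (ε + F (A + 2 * ε) + B * K * 0)) :=
      (Continuous.tendsto (by fun_prop) 0).mono_left nhdsWithin_le_nhds
    rw [mul_zero, add_zero] at hlim
    refine ge_of_tendsto hlim ?_
    filter_upwards [Ioo_mem_nhdsGT hr] with s hs'
    exact hs s hs'.1 hs'.2
  have hlim : Tendsto (fun ε : ℝ => ε + (F A + Λ * (2 * ε))) (𝓝[>] 0)
      (𝓝 (0 + (F A + Λ * (2 * 0)))) :=
    (Continuous.tendsto (by fun_prop) 0).mono_left nhdsWithin_le_nhds
  have : p ≤ 0 + (F A + Λ * (2 * 0)) := by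
    refine ge_of_tendsto hlim ?_
    filter_upwards [self_mem_nhdsWithin] with ε hε
    have hε : 0 < ε := hε
    have := key ε hε
    have := hF.le A (2 * ε) (by linarith)
    linarith
  simp at this
  linarith

/-- The approximations to the solution of the `G`-heat equation with time step `1 / (n + 1)`. -/
noncomputable def approx (G : GFunction) (φ : ℝ → ℝ) (n : ℕ) (t : ℝ) : ℝ → ℝ :=
  (step G (1 / (n + 1)))^[⌊t * (n + 1)⌋₊] φ

/-- The time actually elapsed between `s` and `t` in the scheme with step `1 / (n + 1)`. -/
noncomputable def elapsed (n : ℕ) (s t : ℝ) : ℝ :=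
  ((⌊t * (n + 1)⌋₊ - ⌊s * (n + 1)⌋₊ : ℕ) : ℝ) * (1 / (n + 1))

theorem approx_eq_iterate (G : GFunction) (φ : ℝ → ℝ) (n : ℕ) {s t : ℝ} (hst : s ≤ t) :
    approx G φ n t =
      (step G (1 / (n + 1)))^[⌊t * (n + 1)⌋₊ - ⌊s * (n + 1)⌋₊] (approx G φ n s) := by
  have : ⌊s * ((n : ℝ) + 1)⌋₊ ≤ ⌊t * ((n : ℝ) + 1)⌋₊ := Nat.floor_mono (by gcongr)
  rw [approx, approx, ← Function.iterate_add_apply, Nat.sub_add_cancel this]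

theorem tendsto_elapsed {s t : ℝ} (hs : 0 ≤ s) (hst : s ≤ t) :
    Tendsto (fun n => elapsed n s t) atTop (𝓝 (t - s)) := by
  have hn : Tendsto (fun n : ℕ => (n : ℝ) + 1) atTop atTop :=
    tendsto_atTop_add_const_right _ _ tendsto_natCast_atTop_atTop
  have h1 := (tendsto_nat_floor_mul_div_atTop (hs.trans hst)).comp hn
  have h2 := (tendsto_nat_floor_mul_div_atTop hs).comp hn
  refine (h1.sub h2).congr fun n => ?_
  have : ⌊s * ((n : ℝ) + 1)⌋₊ ≤ ⌊t * ((n : ℝ) + 1)⌋₊ := Nat.floor_mono (by gcongr)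
  simp only [elapsed, Function.comp]
  rw [Nat.cast_sub this]
  ring

theorem abs_le_add_sq {z δ : ℝ} (hδ : 0 < δ) : |z| ≤ δ / 2 + 1 / (2 * δ) * z ^ 2 := by
  have : δ / 2 + 1 / (2 * δ) * z ^ 2 - |z| = (|z| - δ) ^ 2 / (2 * δ) := by
    rw [← sq_abs z]; field_simp; ring
  have h2 : 0 ≤ (|z| - δ) ^ 2 / (2 * δ) := by positivity
  linarith

/-- A Lipschitz function lies between two parabolas at `x` (quartics with `K = 0`), whose evolution
under the scheme is explicit. Small `δ` then yields equicontinuity in time. -/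
theorem abs_step_iterate_sub_le {G : GFunction} {h L δ : ℝ} {f : ℝ → ℝ} (hh : 0 ≤ h) (hL : 0 ≤ L)
    (hδ : 0 < δ) (hf : ∀ x y, f x - f y ≤ L * |x - y|) (k : ℕ) (x : ℝ) :
    |(step G h)^[k] f x - f x| ≤ L * δ / 2 + k * h * (G.sigmaHi ^ 2 / 2 * (L / δ)) := by
  have hb : ∀ y, L * |y - x| ≤ L * δ / 2 + L / δ / 2 * (y - x) ^ 2 := fun y => by
    calc L * |y - x| ≤ L * (δ / 2 + 1 / (2 * δ) * (y - x) ^ 2) :=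
          mul_le_mul_of_nonneg_left (abs_le_add_sq hδ) hL
      _ = _ := by field_simp
  have h1 := step_iterate_le (G := G) (c := f x + L * δ / 2) (p := 0) (a := L / δ) (K := 0)
    (x₀ := x) (f := f) hh le_rfl (fun y => by
      have := hf y x; have := hb y; simp only [quartic]; linarith) k x
  have h2 := le_step_iterate (G := G) (c := f x - L * δ / 2) (p := 0) (a := -(L / δ)) (K := 0)
    (x₀ := x) (f := f) hh le_rfl (fun y => by
      have := hf x y; rw [abs_sub_comm] at this; have := hb y; simp only [quartic]; linarith) k x
  rw [quartic_self] at h1 h2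
  have hq : 0 ≤ L / δ := by positivity
  have e1 : G.eval (L / δ) = G.sigmaHi ^ 2 / 2 * (L / δ) := by
    rw [G.eval_eq_max, max_eq_right]
    have := mul_le_mul_of_nonneg_right G.sq_le hq; linarith
  have e2 : -(G.sigmaHi ^ 2 / 2 * (L / δ)) ≤ G.eval (-(L / δ)) := by
    rw [G.eval_eq_max]; exact le_max_of_le_right (by linarith)
  have hk : 0 ≤ (k : ℝ) * h := by positivity
  have e3 := mul_le_mul_of_nonneg_left e2 hk
  rw [e1] at h1
  rw [abs_le]; constructor <;> linarith

/-- Existence for the `G`-heat equation, with preservation of the Lipschitz constant. -/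
theorem exists_isViscositySolution (G : GFunction) {φ : ℝ → ℝ} (hφ : IsBoundedLipschitz φ) :
    ∃ u, IsViscositySolution G φ u ∧ ∃ L : ℝ, ∀ t x y, u (t, x) - u (t, y) ≤ L * |x - y| := by
  obtain ⟨⟨C, hC⟩, L, hL⟩ := hφ
  have hL' : ∀ x y, φ x - φ y ≤ L * |x - y| := fun x y =>
    (le_abs_self _).trans (by simpa [Real.dist_eq] using hL.dist_le_mul x y)
  have hCn : ∀ n t x, |approx G φ n t x| ≤ C := fun n t x => abs_step_iterate_le hC _ _
  have hLn : ∀ n t x y, approx G φ n t x - approx G φ n t y ≤ L * |x - y| :=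
    fun n t x y => step_iterate_lipschitz hL' _ _ _
  -- Along a nonprincipal ultrafilter every bounded sequence converges, so the limit exists at all
  -- `(t, x)` at once, without extracting subsequences.
  let l : Ultrafilter ℕ := hyperfilter ℕ
  have hex : ∀ t x, ∃ b, Tendsto (fun n => approx G φ n t x) l (𝓝 b) := by
    intro t x
    obtain ⟨b, -, hb⟩ := (isCompact_Icc (a := -C) (b := C)).ultrafilter_le_nhds
      (l.map fun n => approx G φ n t x)
      (tendsto_principal.2 (Eventually.of_forall fun n => abs_le.1 (hCn n t x)))
    exact ⟨b, hb⟩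
  choose v hv using hex
  have hθ : ∀ s t, 0 ≤ s → s ≤ t → Tendsto (fun n => elapsed n s t) l (𝓝 (t - s)) :=
    fun s t hs hst => (tendsto_elapsed hs hst).mono_left Nat.hyperfilter_le_atTop
  have hvC : ∀ t x, |v t x| ≤ C := fun t x =>
    le_of_tendsto (hv t x).abs (Eventually.of_forall fun n => hCn n t x)
  have hvL : ∀ t x y, v t x - v t y ≤ L * |x - y| := fun t x y =>
    le_of_tendsto ((hv t x).sub (hv t y)) (Eventually.of_forall fun n => hLn n t x y)
  have htime : ∀ δ > 0, ∀ s t x, 0 ≤ s → s ≤ t →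
      |v t x - v s x| ≤ L * δ / 2 + (t - s) * (G.sigmaHi ^ 2 / 2 * (L / δ)) := by
    intro δ hδ s t x hs hst
    refine le_of_tendsto_of_tendsto ((hv t x).sub (hv s x)).abs
      (tendsto_const_nhds.add ((hθ s t hs hst).mul_const _)) (Eventually.of_forall fun n => ?_)
    simp only [approx_eq_iterate G φ n hst]
    exact abs_step_iterate_sub_le (by positivity) L.2 hδ (hLn n s) _ _
  refine ⟨fun z => v z.1 z.2, ⟨?_, ⟨C, fun t x _ => hvC t x⟩, ?_, ?_, ?_⟩, L, hvL⟩
  · rintro ⟨t, x⟩ ⟨ht, -⟩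
    rw [Metric.continuousWithinAt_iff']
    intro ε hε
    -- This makes the time-independent part `L δ / 2` of the time modulus smaller than `ε / 2`.
    let δ := ε / (L + 1)
    have hδ : 0 < δ := by positivity
    let M := G.sigmaHi ^ 2 / 2 * (L / δ)
    have hcont : ∀ᶠ z : ℝ × ℝ in 𝓝 (t, x), L * |z.2 - x| + |z.1 - t| * M < ε / 2 := by
      have hc : Continuous fun z : ℝ × ℝ => L * |z.2 - x| + |z.1 - t| * M := by fun_prop
      exact hc.continuousAt.eventually (gt_mem_nhds (by simpa using by linarith))
    filter_upwards [hcont.filter_mono nhdsWithin_le_nhds, self_mem_nhdsWithin] with z hz hz0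
    have hLδ : L * δ / 2 < ε / 2 := by
      have : L * δ < ε := by
        have : ((L : ℝ) + 1) * δ = ε := by simp only [δ]; field_simp
        nlinarith
      linarith
    have h1 : |v z.1 z.2 - v z.1 x| ≤ L * |z.2 - x| := by
      rw [abs_sub_le_iff]
      exact ⟨hvL _ _ _, by rw [abs_sub_comm]; exact hvL _ _ _⟩
    have h2 : |v z.1 x - v t x| ≤ L * δ / 2 + |z.1 - t| * M := by
      rcases le_total t z.1 with h | h
      · rw [abs_of_nonneg (sub_nonneg.2 h)]; exact htime δ hδ t z.1 x ht h
      · rw [abs_sub_comm, abs_sub_comm z.1, abs_of_nonneg (sub_nonneg.2 h)]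
        exact htime δ hδ z.1 t x hz0.1 h
    rw [Real.dist_eq]
    have := abs_sub_le (v z.1 z.2) (v z.1 x) (v t x)
    linarith
  · intro x
    refine tendsto_nhds_unique (hv 0 x) ?_
    simp [approx]
  · refine isSub_of_scheme (l := (l : Filter ℕ)) (C := C) (L := L) (B := 3 * G.sigmaHi ^ 4) G.elliptic
      (fun n t x => (abs_le.1 (hCn n t x)).2) hLn (fun t x _ => hv t x) ?_ hθ
    intro n s t x₀ c p a K hs hst hK hle
    have := step_iterate_le (G := G) (h := 1 / ((n : ℝ) + 1)) (by positivity) hK hle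
      (⌊t * ((n : ℝ) + 1)⌋₊ - ⌊s * ((n : ℝ) + 1)⌋₊) x₀
    rw [← approx_eq_iterate G φ n hst, quartic_self] at this
    simp only [elapsed]
    linarith
  · refine IsSub.isViscositySupersolution (isSub_of_scheme (un := fun n t x => -approx G φ n t x)
      (l := (l : Filter ℕ)) (C := C) (L := L) (B := 3 * G.sigmaHi ^ 4) G.elliptic.dual
      (fun n t x => by linarith [(abs_le.1 (hCn n t x)).1])
      (fun n t x y => by have := hLn n t y x; rw [abs_sub_comm] at this; linarith)
      (fun t x _ => (hv t x).neg) ?_ hθ)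
    intro n s t x₀ c p a K hs hst hK hle
    have := le_step_iterate (G := G) (h := 1 / ((n : ℝ) + 1)) (c := -c) (p := -p) (a := -a)
      (x₀ := x₀) (f := approx G φ n s) (by positivity) hK
      (fun y => by have := hle y; simp only [quartic] at this ⊢; linarith)
      (⌊t * ((n : ℝ) + 1)⌋₊ - ⌊s * ((n : ℝ) + 1)⌋₊) x₀
    rw [← approx_eq_iterate G φ n hst, quartic_self] at this
    simp only [elapsed, dual]
    linarith

/-! ### Random walks below supersolutions of the linear heat equation -/

theorem contDiff_two_of_hasDerivAt {f f' f'' : ℝ → ℝ} (h : ∀ x, HasDerivAt f (f' x) x)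
    (h' : ∀ x, HasDerivAt f' (f'' x) x) (hc : Continuous f'') : ContDiff ℝ 2 f := by
  rw [show (2 : WithTop ℕ∞) = 1 + 1 from rfl, contDiff_succ_iff_deriv]
  refine ⟨fun x => (h x).differentiableAt, by simp, ?_⟩
  rw [show deriv f = f' from funext fun x => (h x).deriv, contDiff_one_iff_deriv]
  refine ⟨fun x => (h' x).differentiableAt, ?_⟩
  rwa [show deriv f' = f'' from funext fun x => (h' x).deriv]

/-- `g` is twice differentiable and `g''` is `M`-Lipschitz. -/
def C2Lip (M : ℝ) (g : ℝ → ℝ) : Prop :=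
  ∃ g' g'' : ℝ → ℝ, (∀ x, HasDerivAt g (g' x) x) ∧ (∀ x, HasDerivAt g' (g'' x) x) ∧
    ∀ x y, |g'' x - g'' y| ≤ M * |x - y|

theorem continuous_of_abs_sub_le {g : ℝ → ℝ} {M : ℝ} (h : ∀ x y, |g x - g y| ≤ M * |x - y|) :
    Continuous g := by
  have hM : 0 ≤ M := by
    have := (abs_nonneg _).trans (h 1 0); simpa using this
  refine (LipschitzWith.of_dist_le_mul (K := M.toNNReal) fun x y => ?_).continuous
  rw [Real.coe_toNNReal M hM]
  exact h x y

/-- Averaging translates does not increase the Lipschitz constant of `g''`, so the one-step error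
stays the same along the iteration. -/
theorem C2Lip.walk {M σ h : ℝ} {g : ℝ → ℝ} (hg : C2Lip M g) : C2Lip M (walk σ h g) := by
  obtain ⟨g', g'', h1, h2, h3⟩ := hg
  have hd : ∀ {f f' : ℝ → ℝ}, (∀ x, HasDerivAt f (f' x) x) →
      ∀ x, HasDerivAt (GNormal.walk σ h f) (GNormal.walk σ h f' x) x := fun hf x =>
    (((hf _).comp_add_const x _).add ((hf _).comp_sub_const x _)).div_const 2
  refine ⟨GNormal.walk σ h g', GNormal.walk σ h g'', hd h1, hd h2, fun x y => ?_⟩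
  have a1 := h3 (x + σ * √h) (y + σ * √h)
  have a2 := h3 (x - σ * √h) (y - σ * √h)
  rw [add_sub_add_right_eq_sub] at a1
  rw [sub_sub_sub_cancel_right] at a2
  rw [abs_le] at *
  simp only [GNormal.walk]
  constructor <;> linarith [a1.1, a1.2, a2.1, a2.2]

theorem abs_walk_le {σ h C : ℝ} {g : ℝ → ℝ} (hg : ∀ x, |g x| ≤ C) (x : ℝ) :
    |walk σ h g x| ≤ C := by
  have h1 := abs_le.1 (hg (x + σ * √h))
  have h2 := abs_le.1 (hg (x - σ * √h))
  rw [abs_le]; simp only [walk]; constructor <;> linarith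

theorem IsSub.mono {F F' : ℝ → ℝ} {u : ℝ × ℝ → ℝ} (hu : IsSub F u) (h : ∀ a, F a ≤ F' a) :
    IsSub F' u := fun ψ hψ t x ht hmax => by
  have := hu ψ hψ t x ht hmax
  linarith [h (iteratedDeriv 2 (fun y => ψ (t, y)) x)]

theorem elliptic_linear (σ : ℝ) : Elliptic (fun a => σ ^ 2 / 2 * a) (σ ^ 2 / 2) where
  nonneg := by positivity
  mono a b hb := by nlinarith [mul_nonneg (sq_nonneg σ) hb]
  le a b _ := by linarith

theorem continuousOn_shift {u : ℝ × ℝ → ℝ} (hu : ContinuousOn u (Ici (0 : ℝ) ×ˢ univ)) {t x : ℝ}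
    (ht : 0 ≤ t) {a b : ℝ} (ha : 0 ≤ a) :
    ContinuousOn (fun z : ℝ × ℝ => u (t + a * z.1, x + b * z.2)) (Ici (0 : ℝ) ×ˢ univ) := by
  refine hu.comp (by fun_prop) ?_
  rintro z ⟨hz, -⟩
  have hz : 0 ≤ z.1 := hz
  exact ⟨by simp only [mem_Ici]; positivity, trivial⟩

theorem HasJet.shifted_walk {g g' g'' : ℝ → ℝ} (h1 : ∀ x, HasDerivAt g (g' x) x)
    (h2 : ∀ x, HasDerivAt g' (g'' x) x) (hc : Continuous g'') (σ : ℝ) {s : ℝ} (hs : 0 < s) (x : ℝ) :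
    HasJet (fun z => g (z.2 + σ * √z.1)) s x (g' (x + σ * √s) * (σ * (1 / (2 * √s))))
      (g'' (x + σ * √s)) := by
  refine ⟨?_, ?_, fun y => g' (y + σ * √s), Eventually.of_forall fun y => ?_, ?_⟩
  · refine (contDiff_two_of_hasDerivAt h1 h2 hc).contDiffAt.comp (s, x)
      (f := fun z : ℝ × ℝ => z.2 + σ * √z.1) ?_
    refine contDiffAt_snd.add (contDiffAt_const.mul ?_)
    exact (Real.contDiffAt_sqrt hs.ne').comp (s, x) (f := fun z : ℝ × ℝ => z.1) contDiffAt_fst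
  · exact (h1 _).comp s (((Real.hasDerivAt_sqrt hs.ne').const_mul σ).const_add x)
  · exact (h1 _).comp_add_const y (σ * √s)
  · exact (h2 _).comp_add_const x (σ * √s)

/-- One random-walk step stays below a supersolution of the linear heat equation, up to
`O(h^{3/2})`. -/
theorem walk_le_of_isSub {σ M C C' c t h : ℝ} {v : ℝ × ℝ → ℝ} {g : ℝ → ℝ} (hσ : 0 < σ)
    (hv : IsSub (fun a => σ ^ 2 / 2 * a) (fun z => -v z))
    (hvc : ContinuousOn v (Ici (0 : ℝ) ×ˢ univ)) (hvb : ∀ t x, 0 ≤ t → |v (t, x)| ≤ C)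
    (hg : C2Lip M g) (hgb : ∀ x, |g x| ≤ C') (ht : 0 ≤ t) (hh : 0 ≤ h)
    (hle : ∀ x, g x - c ≤ v (t, x)) (x : ℝ) :
    walk σ h g x - (c + σ ^ 3 * M * √(2 * h) * h) ≤ v (t + h, x) := by
  rcases hh.eq_or_lt with rfl | hh
  · simpa [walk] using hle x
  obtain ⟨g', g'', h1, h2, h3⟩ := hg
  have hM : 0 ≤ M := by
    have := (abs_nonneg _).trans (h3 1 0); simpa using this
  have hg''c := continuous_of_abs_sub_le h3
  have hgc : Continuous g := continuous_iff_continuousAt.2 fun x => (h1 x).continuousAt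
  -- `E` bounds the defect `σ³ M √s` of `(s, y) ↦ walk σ s g y` in the heat equation for `s < 2h`.
  -- The comparison runs on `[0, 2h)` because its final time is excluded and time `h` is wanted.
  set E := σ ^ 3 * M * √(2 * h)
  have hE : 0 ≤ E := by positivity
  have key := IsSub.le_classical (F := fun a => σ ^ 2 / 2 * a) (Λ := σ ^ 2 / 2) (T := 2 * h)
    (C := C + C' + |c|) (u := fun z => -v (t + 1 * z.1, 0 + 1 * z.2))
    (ψ := fun z => -walk σ z.1 g z.2 + (E * z.1 + c)) (elliptic_linear σ)
    (hv.comp_affine ht one_pos one_pos (by intro A; ring))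
    (continuousOn_shift hvc ht zero_le_one).neg ?_ ?_ ?_ ?_ ?_ (t := h) (x := x) hh.le
    (by linarith)
  · simp only [one_mul, zero_add] at key
    linarith
  · intro s y hs
    have := (abs_le.1 (hvb (t + 1 * s) (0 + 1 * y) (by linarith))).1
    have := (abs_nonneg _).trans (hgb 0)
    have := abs_nonneg c
    simp only; linarith
  · simp only [walk]
    refine Continuous.continuousOn ?_
    fun_prop
  · intro s y hs _
    have h4 := abs_walk_le (σ := σ) (h := s) hgb y
    have := (abs_le.1 h4).2
    have := neg_abs_le c
    have := (abs_nonneg _).trans (hvb 0 0 le_rfl)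
    have : 0 ≤ E * s := by positivity
    simp only; linarith
  · intro s y hs hsT
    have j1 := HasJet.shifted_walk (g := fun x => -(g x / 2)) (g' := fun x => -(g' x / 2))
      (g'' := fun x => -(g'' x / 2)) (fun x => ((h1 x).div_const 2).neg)
      (fun x => ((h2 x).div_const 2).neg) (by fun_prop) σ hs y
    have j2 := HasJet.shifted_walk (g := fun x => -(g x / 2)) (g' := fun x => -(g' x / 2))
      (g'' := fun x => -(g'' x / 2)) (fun x => ((h1 x).div_const 2).neg)
      (fun x => ((h2 x).div_const 2).neg) (by fun_prop) (-σ) hs y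
    have j3 : HasJet (fun z => E * z.1 + c) s y E 0 :=
      HasJet.of_time (a := fun r => E * r + c) (by fun_prop)
        (by simpa using ((hasDerivAt_id s).const_mul E).add_const c)
    have hfun : (fun z : ℝ × ℝ => -walk σ z.1 g z.2 + (E * z.1 + c)) = fun z =>
        -(g (z.2 + σ * √z.1) / 2) + -(g (z.2 + -σ * √z.1) / 2) + (E * z.1 + c) := by
      funext z
      simp only [walk]
      ring_nf
    refine ⟨_, _, hfun ▸ (j1.add j2).add j3, ?_⟩
    · set d := σ * √s
      have hd : 0 < d := by positivity
      -- The time derivative of the walk is a difference quotient of `g'`, equal to `σ²/2 · g''(ξ)`.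
      -- It is compared with `g''` at `y ± d`, both within `2d` of `ξ`.
      obtain ⟨ξ, hξ, hslope⟩ := exists_hasDerivAt_eq_slope g' g'' (a := y - d) (b := y + d)
        (by linarith) (continuous_iff_continuousAt.2 fun x => (h2 x).continuousAt).continuousOn
        (fun x _ => h2 x)
      rw [eq_div_iff (by linarith)] at hslope
      have a1 := h3 ξ (y + d)
      have a2 := h3 ξ (y - d)
      have b1 : |ξ - (y + d)| ≤ 2 * d := by
        rw [abs_le]; constructor <;> linarith [hξ.1, hξ.2]
      have b2 : |ξ - (y - d)| ≤ 2 * d := by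
        rw [abs_le]; constructor <;> linarith [hξ.1, hξ.2]
      have c1 := (abs_le.1 (a1.trans (mul_le_mul_of_nonneg_left b1 hM))).2
      have c2 := (abs_le.1 (a2.trans (mul_le_mul_of_nonneg_left b2 hM))).2
      have hsq : √s ≤ √(2 * h) := Real.sqrt_le_sqrt hsT.le
      have hE' : σ ^ 3 * M * √s ≤ E := mul_le_mul_of_nonneg_left hsq (by positivity)
      have hs0 : √s ≠ 0 := (Real.sqrt_pos.2 hs).ne'
      have hsub : y + -σ * √s = y - d := by simp only [d]; ring
      have e1 : -(g' (y + d) / 2) * (σ * (1 / (2 * √s))) + -(g' (y + -σ * √s) / 2) *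
          (-σ * (1 / (2 * √s))) = -(σ ^ 2 / 2 * g'' ξ) := by
        rw [hsub]
        have : g' (y + d) = g' (y - d) + g'' ξ * (y + d - (y - d)) := by linarith
        rw [this]
        simp only [d]
        field_simp
        ring
      rw [e1, hsub]
      change σ ^ 2 / 2 * (-(g'' (y + d) / 2) + -(g'' (y - d) / 2) + 0) ≤ _
      have e2 : σ ^ 2 / 2 * (M * (2 * d)) = σ ^ 3 * M * √s := by simp only [d]; ring
      have hσ2 : 0 ≤ σ ^ 2 / 2 := by positivity
      have f1 := mul_le_mul_of_nonneg_left c1 hσ2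
      have f2 := mul_le_mul_of_nonneg_left c2 hσ2
      linarith
  · intro y
    have := hle y
    simp only [walk, one_mul, mul_zero, add_zero, zero_add, Real.sqrt_zero, sub_zero]
    linarith

theorem walk_iterate_le_of_isSub {σ M C C' t h : ℝ} {v : ℝ × ℝ → ℝ} {g : ℝ → ℝ} (hσ : 0 < σ)
    (hv : IsSub (fun a => σ ^ 2 / 2 * a) (fun z => -v z))
    (hvc : ContinuousOn v (Ici (0 : ℝ) ×ˢ univ)) (hvb : ∀ t x, 0 ≤ t → |v (t, x)| ≤ C)
    (hg : C2Lip M g) (hgb : ∀ x, |g x| ≤ C') (ht : 0 ≤ t) (hh : 0 ≤ h)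
    (hle : ∀ x, g x ≤ v (t, x)) (k : ℕ) (x : ℝ) :
    (walk σ h)^[k] g x - k * h * (σ ^ 3 * M * √(2 * h)) ≤ v (t + k * h, x) := by
  suffices H : C2Lip M ((walk σ h)^[k] g) ∧ (∀ x, |(walk σ h)^[k] g x| ≤ C') ∧
      ∀ x, (walk σ h)^[k] g x - k * h * (σ ^ 3 * M * √(2 * h)) ≤ v (t + k * h, x) from H.2.2 x
  induction k with
  | zero => simpa using ⟨hg, hgb, hle⟩
  | succ k ih =>
    obtain ⟨i1, i2, i3⟩ := ih
    simp only [Function.iterate_succ_apply']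
    refine ⟨i1.walk, abs_walk_le i2, fun x => ?_⟩
    have := walk_le_of_isSub hσ hv hvc hvb i1 i2 (t := t + k * h) (by positivity) hh i3 x
    rw [show t + ((k + 1 : ℕ) : ℝ) * h = t + k * h + h by push_cast; ring]
    push_cast
    linarith

/-- The accumulated error is `τ σ³ M √(2τ/k)`, which vanishes as `k` grows. The same `k` serves all
`(t, x)`, as is needed to integrate the inequality against a mollifier. -/
theorem exists_walk_iterate_le {σ M C C' τ η : ℝ} {v f : ℝ × ℝ → ℝ} (hσ : 0 < σ)
    (hv : IsSub (fun a => σ ^ 2 / 2 * a) (fun z => -v z))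
    (hvc : ContinuousOn v (Ici (0 : ℝ) ×ˢ univ)) (hvb : ∀ t x, 0 ≤ t → |v (t, x)| ≤ C)
    (hf : ∀ t, C2Lip M fun x => f (t, x)) (hfb : ∀ z, |f z| ≤ C')
    (hle : ∀ t x, 0 ≤ t → f (t, x) ≤ v (t, x)) (hτ : 0 < τ) (hη : 0 < η) :
    ∃ k : ℕ, 0 < k ∧ ∀ t x, 0 ≤ t →
      (walk σ (τ / k))^[k] (fun x => f (t, x)) x - η ≤ v (t + τ, x) := by
  have hlim : Tendsto (fun k : ℕ => τ * (σ ^ 3 * M * √(2 * (τ / k)))) atTop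
      (𝓝 (τ * (σ ^ 3 * M * √(2 * 0)))) := by
    have h1 : Tendsto (fun k : ℕ => τ / (k : ℝ)) atTop (𝓝 0) :=
      tendsto_const_div_atTop_nhds_zero_nat τ
    exact (((Real.continuous_sqrt.tendsto _).comp (h1.const_mul 2)).const_mul _).const_mul _
  simp only [mul_zero, Real.sqrt_zero] at hlim
  obtain ⟨k, hk, hk0⟩ := ((hlim.eventually (gt_mem_nhds hη)).and (eventually_gt_atTop 0)).exists
  refine ⟨k, hk0, fun t x ht => ?_⟩
  have := walk_iterate_le_of_isSub hσ hv hvc hvb (hf t) (fun x => hfb (t, x)) ht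
    (h := τ / k) (by positivity) (fun x => hle t x ht) k x
  rw [mul_div_cancel₀ τ (by exact_mod_cast hk0.ne' : (k : ℝ) ≠ 0)] at this
  linarith

theorem exists_c2Lip_bound {f : ℝ × ℝ → ℝ} (hf : ContDiff ℝ 3 f) (hc : HasCompactSupport f) :
    ∃ M, ∀ t, C2Lip M fun x => f (t, x) := by
  let D : (ℝ × ℝ → ℝ) → ℝ × ℝ → ℝ := fun f z => fderiv ℝ f z (0, 1)
  have hD : ∀ {f : ℝ × ℝ → ℝ}, ContDiff ℝ 1 f → ∀ t x, HasDerivAt (fun x => f (t, x)) (D f (t, x)) x := by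
    intro f hf t x
    have h1 : HasDerivAt (fun x : ℝ => (t, x)) ((0 : ℝ), (1 : ℝ)) x :=
      (hasDerivAt_const x t).prodMk (hasDerivAt_id x)
    exact (hf.differentiable one_ne_zero (t, x)).hasFDerivAt.comp_hasDerivAt x h1
  have hDc : ∀ {f : ℝ × ℝ → ℝ}, HasCompactSupport f → HasCompactSupport (D f) := fun h =>
    HasCompactSupport.comp_left (h.fderiv (𝕜 := ℝ)) (g := fun L : ℝ × ℝ →L[ℝ] ℝ => L (0, 1)) rfl
  have h1 : ContDiff ℝ 2 (D f) := (hf.fderiv_right (by norm_num)).clm_apply contDiff_const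
  have h2 : ContDiff ℝ 1 (D (D f)) := (h1.fderiv_right (by norm_num)).clm_apply contDiff_const
  have h3 : ContDiff ℝ 0 (D (D (D f))) := (h2.fderiv_right (by norm_num)).clm_apply contDiff_const
  obtain ⟨M, hM⟩ := (hDc (hDc (hDc hc))).exists_bound_of_continuous h3.continuous
  refine ⟨M, fun t => ⟨_, _, hD (hf.of_le (by norm_num)) t, hD (h1.of_le (by norm_num)) t, ?_⟩⟩
  intro x y
  exact convex_univ.norm_image_sub_le_of_norm_hasDerivWithin_le
    (fun z _ => (hD h2 t z).hasDerivWithinAt) (fun z _ => hM (t, z)) (mem_univ y) (mem_univ x)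

/-- Smooth approximation from below on compact sets, with uniform bounds. -/
theorem exists_c2Lip_approx {V : ℝ × ℝ → ℝ} {C : ℝ} (hV : Continuous V) (hVb : ∀ z, |V z| ≤ C)
    {R δ : ℝ} (hR : 0 < R) (hδ : 0 < δ) (hδ1 : δ ≤ 1) :
    ∃ f : ℝ × ℝ → ℝ, Continuous f ∧ (∃ M, ∀ t, C2Lip M fun x => f (t, x)) ∧
      (∀ z, |f z| ≤ C + 1) ∧ (∀ z, f z ≤ V z) ∧ ∀ z ∈ Metric.closedBall 0 R, V z - δ ≤ f z := by
  let χ : ContDiffBump (0 : ℝ × ℝ) := ⟨R, R + 1, hR, by linarith⟩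
  have huc := (isCompact_closedBall (0 : ℝ × ℝ) (R + 2)).uniformContinuousOn_of_continuous
    hV.continuousOn
  obtain ⟨ρ, hρ, hρV⟩ := Metric.uniformContinuousOn_iff.1 huc (δ / 2) (by linarith)
  obtain ⟨F, hF, hFV⟩ := hV.exists_contDiff_dist_le_of_forall_mem_ball_dist_le
    (lt_min one_pos hρ)
  have hclose : ∀ z ∈ Metric.closedBall (0 : ℝ × ℝ) (R + 1), |F z - V z| ≤ δ / 2 := by
    intro z hz
    refine hFV z _ fun y hy => (hρV y ?_ z ?_ ?_).le
    · have := dist_triangle y z 0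
      have h1 : dist y z < 1 := lt_of_lt_of_le hy (min_le_left _ _)
      have h2 : dist z 0 ≤ R + 1 := hz
      rw [Metric.mem_closedBall]; linarith
    · exact Metric.closedBall_subset_closedBall (by linarith) hz
    · exact lt_of_lt_of_le hy (min_le_right _ _)
  -- Raising by `C + 1` makes the bracket nonnegative on the support of `χ` (here `δ ≤ 1` enters),
  -- so the cut-off only lowers it; after lowering back the function stays below `V` everywhere.
  let g : ℝ × ℝ → ℝ := fun z => χ z * (F z - δ / 2 + C + 1)
  have hg : ContDiff ℝ 3 g := χ.contDiff.mul
    ((((hF.of_le (by norm_cast)).sub contDiff_const).add contDiff_const).add contDiff_const)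
  have hgc : HasCompactSupport g := χ.hasCompactSupport.mul_right
  have hupper : ∀ z, g z - (C + 1) ≤ V z := by
    intro z
    have hVz := abs_le.1 (hVb z)
    by_cases hz : z ∈ Metric.closedBall (0 : ℝ × ℝ) (R + 1)
    · have h1 := abs_le.1 (hclose z hz)
      have : g z ≤ F z - δ / 2 + C + 1 :=
        mul_le_of_le_one_left (by linarith) χ.le_one
      linarith
    · have : χ z = 0 := χ.zero_of_le_dist (by
        rw [Metric.mem_closedBall, not_le] at hz; exact hz.le)
      simp only [g, this, zero_mul]; linarith
  have hlower : ∀ z, 0 ≤ g z := by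
    intro z
    have hVz := abs_le.1 (hVb z)
    by_cases hz : z ∈ Metric.closedBall (0 : ℝ × ℝ) (R + 1)
    · have h1 := abs_le.1 (hclose z hz)
      exact mul_nonneg χ.nonneg (by linarith)
    · have : χ z = 0 := χ.zero_of_le_dist (by
        rw [Metric.mem_closedBall, not_le] at hz; exact hz.le)
      simp only [g, this, zero_mul]; exact le_rfl
  obtain ⟨M, hM⟩ := exists_c2Lip_bound hg hgc
  refine ⟨fun z => g z - (C + 1), hg.continuous.sub continuous_const, ⟨M, fun t => ?_⟩, ?_, hupper, ?_⟩
  · obtain ⟨a, b, h1, h2, h3⟩ := hM t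
    exact ⟨a, b, fun x => (h1 x).sub_const _, h2, h3⟩
  · intro z
    have := abs_le.1 (hVb z)
    rw [abs_le]; constructor <;> linarith [hupper z, hlower z]
  · intro z hz
    have h1 := abs_le.1 (hclose z (Metric.closedBall_subset_closedBall (by linarith) hz))
    have : χ z = 1 := χ.one_of_mem_closedBall hz
    simp only [g, this, one_mul]; linarith

/-! ### Mollified supersolutions of the linear heat equation -/

/-- Mollification by a normalized bump function. -/
noncomputable def moll (ρ : ContDiffBump (0 : ℝ × ℝ)) (g : ℝ × ℝ → ℝ) (z : ℝ × ℝ) : ℝ :=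
  ∫ q, ρ.normed volume q * g (z - q)

section Mollification

variable (ρ : ContDiffBump (0 : ℝ × ℝ))

theorem moll_integrable {g : ℝ × ℝ → ℝ} (hg : Continuous g) (z : ℝ × ℝ) :
    Integrable fun q => ρ.normed volume q * g (z - q) :=
  (ρ.continuous_normed.mul (by fun_prop)).integrable_of_hasCompactSupport
    ρ.hasCompactSupport_normed.mul_right

theorem contDiff_moll {g : ℝ × ℝ → ℝ} (hg : Continuous g) : ContDiff ℝ 2 (moll ρ g) :=
  ρ.hasCompactSupport_normed.contDiff_convolution_left (n := 2) (ContinuousLinearMap.lsmul ℝ ℝ)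
    ρ.contDiff_normed hg.locallyIntegrable

theorem moll_add_const {g : ℝ × ℝ → ℝ} (hg : Continuous g) (c : ℝ) (z : ℝ × ℝ) :
    moll ρ (fun y => g y + c) z = moll ρ g z + c := by
  simp only [moll, mul_add]
  rw [integral_add (moll_integrable ρ hg z) (ρ.integrable_normed.mul_const c), integral_mul_const,
    ρ.integral_normed, one_mul]

theorem moll_const (c : ℝ) (z : ℝ × ℝ) : moll ρ (fun _ => c) z = c := by
  simp only [moll]
  rw [integral_mul_const, ρ.integral_normed, one_mul]

theorem moll_le_moll {g g' : ℝ × ℝ → ℝ} (hg : Continuous g) (hg' : Continuous g') {z : ℝ × ℝ}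
    (h : ∀ y, dist y z < ρ.rOut → g y ≤ g' y) : moll ρ g z ≤ moll ρ g' z := by
  refine integral_mono (moll_integrable ρ hg z) (moll_integrable ρ hg' z) fun q => ?_
  by_cases hq : q ∈ Metric.ball (0 : ℝ × ℝ) ρ.rOut
  · refine mul_le_mul_of_nonneg_left (h _ ?_) (ρ.nonneg_normed q)
    rw [dist_eq_norm, sub_sub_cancel_left, norm_neg]
    simpa using hq
  · have : ρ.normed volume q = 0 := by
      rw [← Function.notMem_support, ρ.support_normed_eq]; exact hq
    simp [this]

/-- The spatial random-walk step on functions of `(t, x)`. -/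
noncomputable def spaceWalk (σ h : ℝ) (g : ℝ × ℝ → ℝ) (z : ℝ × ℝ) : ℝ :=
  walk σ h (fun x => g (z.1, x)) z.2

theorem continuous_spaceWalk {σ h : ℝ} {g : ℝ × ℝ → ℝ} (hg : Continuous g) :
    Continuous (spaceWalk σ h g) := by
  unfold spaceWalk walk; fun_prop

/-- Both operators are averages of translates, hence commute. The maximum in `step` would destroy
this, which is why the two linear equations are treated separately. -/
theorem moll_spaceWalk {σ h : ℝ} {g : ℝ × ℝ → ℝ} (hg : Continuous g) :
    moll ρ (spaceWalk σ h g) = spaceWalk σ h (moll ρ g) := by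
  funext z
  have e : ∀ q : ℝ × ℝ, ρ.normed volume q * spaceWalk σ h g (z - q) =
      (ρ.normed volume q * g ((z.1, z.2 + σ * √h) - q) +
        ρ.normed volume q * g ((z.1, z.2 - σ * √h) - q)) / 2 := by
    rintro ⟨a, b⟩
    simp only [spaceWalk, walk, Prod.fst_sub, Prod.snd_sub, Prod.mk_sub_mk]
    rw [show z.2 - b + σ * √h = z.2 + σ * √h - b by ring,
      show z.2 - b - σ * √h = z.2 - σ * √h - b by ring]
    ring
  simp only [moll, e]
  rw [integral_div, integral_add (moll_integrable ρ hg _) (moll_integrable ρ hg _)]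
  rfl

theorem moll_spaceWalk_iterate {σ h : ℝ} {g : ℝ × ℝ → ℝ} (hg : Continuous g) (k : ℕ) :
    Continuous ((spaceWalk σ h)^[k] g) ∧
      moll ρ ((spaceWalk σ h)^[k] g) = (spaceWalk σ h)^[k] (moll ρ g) := by
  induction k with
  | zero => exact ⟨hg, rfl⟩
  | succ k ih =>
    simp only [Function.iterate_succ_apply']
    exact ⟨continuous_spaceWalk ih.1, by rw [moll_spaceWalk ρ ih.1, ih.2]⟩

theorem spaceWalk_iterate (σ h : ℝ) (g : ℝ × ℝ → ℝ) (k : ℕ) (t x : ℝ) :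
    (spaceWalk σ h)^[k] g (t, x) = (walk σ h)^[k] (fun x => g (t, x)) x := by
  induction k generalizing x with
  | zero => rfl
  | succ k ih =>
    simp only [Function.iterate_succ_apply', spaceWalk]
    congr 1
    funext y
    exact ih y

/-- The linear walk is the scheme of the `G` with `σlo = σhi = σ`, so the bound for `step` applies.
-/
theorem le_walk_iterate {σ h c p a K x₀ : ℝ} {f : ℝ → ℝ} (hσ : 0 ≤ σ) (hh : 0 ≤ h) (hK : 0 ≤ K)
    (hf : ∀ y, quartic c p a (-K) x₀ y ≤ f y) (k : ℕ) :
    c + k * h * (σ ^ 2 / 2 * a) - 3 * K * σ ^ 4 * (k * h) ^ 2 ≤ (walk σ h)^[k] f x₀ := by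
  let G : GFunction := ⟨σ, σ, hσ, le_rfl⟩
  have hs : step G h = walk σ h := by
    funext f x; exact max_self _
  have := le_step_iterate (G := G) hh hK hf k x₀
  rw [quartic_self, hs, G.eval_eq_max] at this
  simpa [G] using this

/-- Mollifications of supersolutions of the linear heat equation are classical supersolutions. -/
theorem moll_isSupersolution {σ C : ℝ} {v : ℝ × ℝ → ℝ} (hσ : 0 < σ)
    (hv : IsSub (fun a => σ ^ 2 / 2 * a) (fun z => -v z))
    (hvc : ContinuousOn v (Ici (0 : ℝ) ×ˢ univ)) (hvb : ∀ t x, 0 ≤ t → |v (t, x)| ≤ C)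
    {V : ℝ × ℝ → ℝ} (hV : Continuous V) (hVb : ∀ z, |V z| ≤ C)
    (hVv : ∀ t x, 0 ≤ t → V (t, x) = v (t, x))
    {t x p A : ℝ} (ht : ρ.rOut < t) (hj : HasJet (moll ρ V) t x p A) : σ ^ 2 / 2 * A ≤ p := by
  have hρ := ρ.rOut_pos
  set W := moll ρ V
  have key : ∀ ε > 0, σ ^ 2 / 2 * (A - 2 * ε) ≤ p + ε := by
    intro ε hε
    obtain ⟨q, r, hr, htay⟩ := hj.taylor hε
    obtain ⟨K, hK, hquart⟩ := exists_le_quartic (-W (t, x)) (-q) (-(A - 2 * ε)) (C + 1) hr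
    -- A smooth `f` slightly below `V` is run through the walk, which stays below `v(t + τ, ·)` up
    -- to `δ`; mollifying both sides and commuting leaves the walk applied to `moll ρ f`, which is
    -- bounded below by a quartic touching `W` up to `δ`.
    have hstep : ∀ τ > 0, W (t, x) + τ * (σ ^ 2 / 2 * (A - 2 * ε)) - 3 * K * σ ^ 4 * τ ^ 2 ≤
        W (t + τ, x) := by
      intro τ hτ
      have hδ : ∀ δ > 0, δ ≤ 1 → W (t, x) + τ * (σ ^ 2 / 2 * (A - 2 * ε)) - 3 * K * σ ^ 4 * τ ^ 2
          ≤ W (t + τ, x) + 2 * δ := by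
        intro δ hδ hδ1
        let R := |t| + |x| + r + ρ.rOut
        obtain ⟨f, hfc, ⟨M, hfM⟩, hfb, hfV, hfR⟩ :=
          exists_c2Lip_approx hV hVb (R := R) (by positivity) hδ hδ1
        obtain ⟨k, hk, hkle⟩ := exists_walk_iterate_le (f := f) hσ hv hvc hvb hfM hfb
          (fun t x ht => hVv t x ht ▸ hfV (t, x)) hτ hδ
        have hkτ : (k : ℝ) * (τ / k) = τ := mul_div_cancel₀ τ (by exact_mod_cast hk.ne')
        obtain ⟨hBc, hB⟩ := moll_spaceWalk_iterate ρ (σ := σ) (h := τ / k) hfc k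
        have h1 : moll ρ ((spaceWalk σ (τ / k))^[k] f) (t, x) - δ ≤ W (t + τ, x) := by
          have e : W (t + τ, x) = moll ρ (fun y => V (y.1 + τ, y.2)) (t, x) := by
            simp only [W, moll]
            congr 1; funext q
            congr 2
            ext <;> simp; ring
          rw [e, sub_eq_add_neg, ← moll_add_const ρ hBc]
          refine moll_le_moll ρ (hBc.add continuous_const) (by fun_prop) fun y hy => ?_
          -- Because `ρ.rOut < t`, the mollifier only sees nonnegative times, where `V = v`.
          have hy1 : 0 ≤ y.1 := by
            have h2 : dist y.1 t < ρ.rOut := lt_of_le_of_lt (le_max_left _ _) hy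
            have := (abs_lt.1 h2).1
            linarith
          have h3 := hkle y.1 y.2 hy1
          rw [← spaceWalk_iterate, ← hVv _ _ (by linarith)] at h3
          exact h3
        have h2 : ∀ y, quartic (W (t, x) - δ) q (A - 2 * ε) (-K) x y ≤ moll ρ f (t, y) := by
          intro y
          rcases lt_or_ge |y - x| r with hy | hy
          · have h3 := htay 0 (y - x) (by simpa using hr) hy
            rw [add_zero, add_sub_cancel, abs_zero] at h3
            have h4 : W (t, y) - δ ≤ moll ρ f (t, y) := by
              rw [sub_eq_add_neg]
              simp only [W]
              rw [← moll_add_const ρ hV]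
              refine moll_le_moll ρ (by fun_prop) hfc fun z hz => ?_
              refine hfR z ?_
              rw [Metric.mem_closedBall, dist_zero_right]
              have h5 : ‖z‖ ≤ ‖z - (t, y)‖ + ‖((t, y) : ℝ × ℝ)‖ := by
                simpa using norm_add_le (z - (t, y)) (t, y)
              have h6 : ‖((t, y) : ℝ × ℝ)‖ ≤ |t| + |x| + r := by
                rw [Prod.norm_mk, Real.norm_eq_abs, Real.norm_eq_abs]
                have : |y| ≤ |y - x| + |x| := by simpa using abs_add_le (y - x) x
                have := abs_nonneg x
                have := abs_nonneg t
                exact max_le (by linarith) (by linarith)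
              rw [← dist_eq_norm] at h5
              simp only [R]; linarith
            have h5 : 0 ≤ K * (y - x) ^ 4 := by positivity
            have h6 := (abs_le.1 h3).1
            simp only [quartic]
            nlinarith
          · have h3 := hquart (-W (t, x) + δ) x y (by linarith) hy
            have h4 : -(C + 1) ≤ moll ρ f (t, y) := by
              rw [← moll_const ρ (-(C + 1)) (t, y)]
              exact moll_le_moll ρ continuous_const hfc fun z _ => (abs_le.1 (hfb z)).1
            simp only [quartic] at h3 ⊢
            linarith
        have h3 := le_walk_iterate hσ.le (h := τ / k) (by positivity) hK h2 k
        rw [hB, spaceWalk_iterate] at h1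
        rw [hkτ] at h3
        linarith
      refine le_of_forall_pos_le_add fun δ hδ0 => ?_
      have := hδ (min (δ / 2) 1) (by positivity) (min_le_right _ _)
      have := min_le_left (δ / 2) 1
      linarith
    have hlim : Tendsto (fun τ : ℝ => p + ε + 3 * K * σ ^ 4 * τ) (𝓝[>] 0)
        (𝓝 (p + ε + 3 * K * σ ^ 4 * 0)) :=
      (Continuous.tendsto (by fun_prop) 0).mono_left nhdsWithin_le_nhds
    rw [mul_zero, add_zero] at hlim
    refine ge_of_tendsto hlim ?_
    filter_upwards [Ioo_mem_nhdsGT hr] with τ hτ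
    have h1 := hstep τ hτ.1
    have h2 := htay τ 0 (by rw [abs_of_pos hτ.1]; exact hτ.2) (by simpa using hr)
    rw [add_zero, abs_of_pos hτ.1] at h2
    have h3 := (abs_le.1 h2).2
    refine le_of_mul_le_mul_left ?_ hτ.1
    nlinarith
  have hlim : Tendsto (fun ε : ℝ => p + ε + σ ^ 2 * ε) (𝓝[>] 0) (𝓝 (p + 0 + σ ^ 2 * 0)) :=
    (Continuous.tendsto (by fun_prop) 0).mono_left nhdsWithin_le_nhds
  rw [mul_zero, add_zero, add_zero] at hlim
  refine ge_of_tendsto hlim ?_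
  filter_upwards [self_mem_nhdsWithin] with ε hε
  linarith [key ε hε]

end Mollification

/-! ### The comparison principle and uniqueness -/

theorem HasJet.shift_time {ψ : ℝ × ℝ → ℝ} {r t x p A : ℝ} (h : HasJet ψ (t + r) x p A) :
    HasJet (fun z => ψ (z.1 + r, z.2)) t x p A :=
  ⟨ContDiffAt.comp (g := ψ) (f := fun z : ℝ × ℝ => (z.1 + r, z.2)) (t, x) h.contDiffAt (by fun_prop),
    h.time.comp_add_const t r, h.space⟩

/-- The comparison principle for bounded continuous viscosity sub- and supersolutions. -/
theorem comparison {G : GFunction} (hG : G.Nondegenerate) {C : ℝ} {u v : ℝ × ℝ → ℝ}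
    (hu : IsSub G.eval u) (hv : IsSub (dual G.eval) (fun z => -v z))
    (huc : ContinuousOn u (Ici (0 : ℝ) ×ˢ univ)) (hvc : ContinuousOn v (Ici (0 : ℝ) ×ˢ univ))
    (hub : ∀ t x, 0 ≤ t → |u (t, x)| ≤ C) (hvb : ∀ t x, 0 ≤ t → |v (t, x)| ≤ C)
    (h0 : ∀ x, u (0, x) ≤ v (0, x)) {t x : ℝ} (ht : 0 ≤ t) : u (t, x) ≤ v (t, x) := by
  have hlo : 0 < G.sigmaLo := hG
  have hhi : 0 < G.sigmaHi := hlo.trans_le G.sigmaLo_le_sigmaHi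
  have hC : 0 ≤ C := (abs_nonneg _).trans (hub 0 0 le_rfl)
  -- `G` dominates each of its two linear branches, so `v` is a supersolution of both linear
  -- equations.
  have hvlo : IsSub (fun a => G.sigmaLo ^ 2 / 2 * a) (fun z => -v z) := hv.mono fun a => by
    have := le_max_left (G.sigmaLo ^ 2 / 2 * -a) (G.sigmaHi ^ 2 / 2 * -a)
    simp only [dual, G.eval_eq_max]; linarith
  have hvhi : IsSub (fun a => G.sigmaHi ^ 2 / 2 * a) (fun z => -v z) := hv.mono fun a => by
    have := le_max_right (G.sigmaLo ^ 2 / 2 * -a) (G.sigmaHi ^ 2 / 2 * -a)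
    simp only [dual, G.eval_eq_max]; linarith
  let V : ℝ × ℝ → ℝ := fun z => v (max z.1 0, z.2)
  have hV : Continuous V := by
    rw [← continuousOn_univ]
    refine hvc.comp (Continuous.continuousOn (by fun_prop)) fun z _ => ⟨le_max_right z.1 0, trivial⟩
  have hVb : ∀ z, |V z| ≤ C := fun z => hvb _ _ (le_max_right _ _)
  have hVv : ∀ t x, 0 ≤ t → V (t, x) = v (t, x) := fun t x ht => by
    simp only [V, max_eq_left ht]
  -- Of the constant 2, one unit pays for the mollification error at time `0` and one for that at
  -- time `t`.
  suffices H : ∀ α > 0, u (t, x) ≤ v (t, x) + α * (2 + x ^ 2 + G.sigmaHi ^ 2 * t) by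
    have hl : Tendsto (fun α : ℝ => v (t, x) + α * (2 + x ^ 2 + G.sigmaHi ^ 2 * t))
        (𝓝[>] 0) (𝓝 (v (t, x) + 0 * (2 + x ^ 2 + G.sigmaHi ^ 2 * t))) :=
      ((Continuous.tendsto (by fun_prop) 0).mono_left nhdsWithin_le_nhds)
    refine (ge_of_tendsto hl (?_)).trans (by simp)
    filter_upwards [self_mem_nhdsWithin] with α hα using H α hα
  intro α hα
  -- Beyond `R` the penalty `α y²` exceeds `2C` and the initial inequality is automatic, so
  -- closeness of the mollification is needed only on a compact set.
  let R := √(2 * C / α)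
  let S := R + |x| + t + 2
  have huc' := (isCompact_closedBall (0 : ℝ × ℝ) S).uniformContinuousOn_of_continuous
    hV.continuousOn
  obtain ⟨d, hd, hdV⟩ := Metric.uniformContinuousOn_iff.1 huc' α hα
  let r := min 1 d / 2
  have hr : 0 < r := by positivity
  have hr1 : 2 * r ≤ 1 := by simp only [r]; linarith [min_le_left 1 d]
  have hrd : 2 * r ≤ d := by simp only [r]; linarith [min_le_right 1 d]
  let ρ : ContDiffBump (0 : ℝ × ℝ) := ⟨r / 2, r, by positivity, by linarith⟩
  have hclose : ∀ s y, 0 ≤ s → s ≤ t → |y| ≤ R + |x| →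
      |moll ρ V (s + r, y) - V (s, y)| ≤ α := by
    intro s y hs hst hy
    have hnorm : ‖((s, y) : ℝ × ℝ)‖ ≤ R + |x| + t := by
      rw [Prod.norm_mk, Real.norm_eq_abs, Real.norm_eq_abs, abs_of_nonneg hs]
      have := abs_nonneg y
      exact max_le (by linarith) (by linarith)
    have hnear : ∀ z, dist z (s + r, y) < r → |V z - V (s, y)| ≤ α := by
      intro z hz
      have hdist : dist z (s, y) < 2 * r := by
        have h1 := dist_triangle z (s + r, y) (s, y)
        have h2 : dist ((s + r, y) : ℝ × ℝ) (s, y) = r := by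
          simp [Prod.dist_eq, abs_of_pos hr, hr.le]
        linarith
      refine (hdV z ?_ (s, y) ?_ (by linarith)).le
      · rw [Metric.mem_closedBall, dist_zero_right]
        have h5 : ‖z‖ ≤ ‖z - (s, y)‖ + ‖((s, y) : ℝ × ℝ)‖ := by
          simpa using norm_add_le (z - (s, y)) (s, y)
        rw [← dist_eq_norm] at h5
        simp only [S]; linarith
      · rw [Metric.mem_closedBall, dist_zero_right]
        simp only [S]; linarith
    have l1 : moll ρ (fun _ => V (s, y) - α) (s + r, y) ≤ moll ρ V (s + r, y) :=
      moll_le_moll ρ continuous_const hV fun z hz => by linarith [(abs_le.1 (hnear z hz)).1]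
    have l2 : moll ρ V (s + r, y) ≤ moll ρ (fun _ => V (s, y) + α) (s + r, y) :=
      moll_le_moll ρ hV continuous_const fun z hz => by linarith [(abs_le.1 (hnear z hz)).2]
    rw [moll_const] at l1 l2
    rw [abs_le]; constructor <;> linarith
  have hMb : ∀ z, -C ≤ moll ρ V z := fun z => by
    rw [← moll_const ρ (-C) z]
    exact moll_le_moll ρ continuous_const hV fun y _ => (abs_le.1 (hVb y)).1
  have hMs := contDiff_moll ρ hV
  -- The shift by `r = ρ.rOut` in time keeps the mollifier inside positive times. The term `α σhi²
  -- t` repays the cost of `α x²` in `G`.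
  have key := hu.le_classical (T := t + 1) (C := C) (t := t) (x := x)
    (ψ := fun z => moll ρ V (z.1 + r, z.2) + (α * z.2 ^ 2 + α * (G.sigmaHi ^ 2 * z.1 + 1)))
    G.elliptic huc (fun t x ht => (abs_le.1 (hub t x ht)).2) ?_ ?_ ?_ ?_ ht (by linarith)
  · have h1 := (abs_le.1 (hclose t x ht le_rfl (by
      have : 0 ≤ R := Real.sqrt_nonneg _
      linarith))).2
    rw [hVv t x ht] at h1
    simp only at key
    linarith
  · have := hMs.continuous
    exact Continuous.continuousOn (by fun_prop)
  · intro s y hs _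
    have := hMb (s + r, y)
    have : 0 ≤ α * y ^ 2 + α * (G.sigmaHi ^ 2 * s + 1) := by positivity
    simp only; linarith
  · intro s y hs _
    have hj := HasJet.of_contDiffAt (hMs.contDiffAt (x := (s + r, y)))
    set p := deriv (fun s => moll ρ V (s, y)) (s + r)
    set A := iteratedDeriv 2 (fun y => moll ρ V (s + r, y)) y
    have i1 := moll_isSupersolution ρ hlo hvlo hvc hvb hV hVb hVv
      (show r < s + r by linarith) hj
    have i2 := moll_isSupersolution ρ hhi hvhi hvc hvb hV hVb hVv
      (show r < s + r by linarith) hj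
    have j1 : HasJet (fun z => α * z.2 ^ 2) s y 0 (2 * α) := by
      refine HasJet.of_space (f := fun y => α * y ^ 2) (f' := fun y => α * (2 * y)) (by fun_prop)
        (Eventually.of_forall fun z => ?_) ?_
      · simpa using (hasDerivAt_pow 2 z).const_mul α
      · have := ((hasDerivAt_id y).const_mul 2).const_mul α
        exact this.congr_deriv (by ring)
    have j2 : HasJet (fun z => α * (G.sigmaHi ^ 2 * z.1 + 1)) s y (α * G.sigmaHi ^ 2) 0 := by
      refine HasJet.of_time (a := fun r => α * (G.sigmaHi ^ 2 * r + 1)) (by fun_prop) ?_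
      simpa using (((hasDerivAt_id s).const_mul (G.sigmaHi ^ 2)).add_const 1).const_mul α
    refine ⟨_, _, hj.shift_time.add (j1.add j2), ?_⟩
    have h1 := G.elliptic.le A (2 * α) (by positivity)
    -- The two linear inequalities combine into the nonlinear one because `G` is their maximum.
    have h2 : G.eval A ≤ p := by rw [G.eval_eq_max]; exact max_le i1 i2
    rw [add_zero]
    linarith
  · intro y
    rcases le_or_gt |y| R with hy | hy
    · have h1 := (abs_le.1 (hclose 0 y le_rfl ht (by have := abs_nonneg x; linarith))).1
      rw [hVv 0 y le_rfl] at h1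
      have := h0 y
      have : 0 ≤ α * y ^ 2 := by positivity
      simp only at *
      linarith
    · have h1 : 2 * C ≤ α * y ^ 2 := by
        have : √(2 * C / α) < |y| := hy
        rw [Real.sqrt_lt' ((Real.sqrt_nonneg _).trans_lt this), sq_abs, div_lt_iff₀ hα] at this
        linarith
      have := hMb (0 + r, y)
      have := (abs_le.1 (hub 0 y le_rfl)).2
      simp only
      linarith

theorem IsViscositySolution.eq {G : GFunction} (hG : G.Nondegenerate) {φ : ℝ → ℝ}
    {u v : ℝ × ℝ → ℝ} (hu : IsViscositySolution G φ u) (hv : IsViscositySolution G φ v) {t x : ℝ}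
    (ht : 0 ≤ t) : u (t, x) = v (t, x) := by
  obtain ⟨C, hC⟩ := hu.bounded
  obtain ⟨C', hC'⟩ := hv.bounded
  have h1 : ∀ t x, 0 ≤ t → |u (t, x)| ≤ max C C' := fun t x ht => (hC t x ht).trans (le_max_left _ _)
  have h2 : ∀ t x, 0 ≤ t → |v (t, x)| ≤ max C C' := fun t x ht => (hC' t x ht).trans (le_max_right _ _)
  exact le_antisymm
    (comparison hG hu.subsolution hv.supersolution.isSub_dual hu.continuousOn hv.continuousOn
      h1 h2 (fun x => by rw [hu.initial, hv.initial]) ht)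
    (comparison hG hv.subsolution hu.supersolution.isSub_dual hv.continuousOn hu.continuousOn
      h2 h1 (fun x => by rw [hu.initial, hv.initial]) ht)

/-- Uniqueness makes the chosen solution in `gNormal` irrelevant; from here on any solution computes
it. -/
theorem IsViscositySolution.gNormal_eq {G : GFunction} (hG : G.Nondegenerate) {φ : ℝ → ℝ}
    {u : ℝ × ℝ → ℝ} (hu : IsViscositySolution G φ u) : gNormal G φ = u (1, 0) := by
  have h : ∃ u : ℝ × ℝ → ℝ, IsViscositySolution G φ u := ⟨u, hu⟩
  rw [gNormal, dif_pos h]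
  exact h.choose_spec.eq hG hu zero_le_one

/-! ### Scaling, and commutativity for equal ratios -/

theorem IsViscositySolution.comp_affine {G G' : GFunction} {φ : ℝ → ℝ} {u : ℝ × ℝ → ℝ}
    (hu : IsViscositySolution G φ u) {t₀ a b x₀ : ℝ} (ht₀ : 0 ≤ t₀) (ha : 0 < a) (hb : 0 < b)
    (hG : ∀ A, G'.eval A = a * G.eval (A / b ^ 2)) :
    IsViscositySolution G' (fun x => u (t₀, x₀ + b * x))
      (fun z => u (t₀ + a * z.1, x₀ + b * z.2)) where
  continuousOn := continuousOn_shift hu.continuousOn ht₀ ha.le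
  bounded := hu.bounded.imp fun C hC t x ht => hC _ _ (by positivity)
  initial x := by simp
  subsolution := IsSub.comp_affine hu.subsolution ht₀ ha hb hG
  supersolution := IsSub.isViscositySupersolution
    (hu.supersolution.isSub_dual.comp_affine ht₀ ha hb fun A => by
      simp only [dual, hG, neg_div]; ring)

theorem GFunction.eval_mul (G : GFunction) {c : ℝ} (hc : 0 ≤ c) (a : ℝ) :
    G.eval (c * a) = c * G.eval a := by
  rw [G.eval_eq_max, G.eval_eq_max, mul_max_of_nonneg _ _ hc]
  congr 1 <;> ring

/-- Parabolic scaling: `G` is positively homogeneous of degree one, so `u(c t, √c y)` solves the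
same equation. -/
theorem gNormal_scaled {G : GFunction} (hG : G.Nondegenerate) {φ : ℝ → ℝ} {u : ℝ × ℝ → ℝ}
    (hu : IsViscositySolution G φ u) {c : ℝ} (hc : 0 < c) (x : ℝ) :
    gNormal G (fun y => φ (√c * (x + y))) = u (c, √c * x) := by
  have hb : 0 < √c := Real.sqrt_pos.2 hc
  have := (hu.comp_affine (G' := G) (t₀ := 0) (a := c) (b := √c) (x₀ := √c * x) le_rfl hc hb
    (fun A => by rw [← G.eval_mul hc.le, Real.sq_sqrt hc.le, mul_div_cancel₀ _ hc.ne'])).gNormal_eq hG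
  simp only [hu.initial, zero_add, mul_one, mul_zero, add_zero, ← mul_add] at this
  exact this

/-- A factor `c` in `G` is a change of clock, and restarting at `t₀` is the semigroup property. -/
theorem gNormal_shifted {G G' : GFunction} (hG' : G'.Nondegenerate) {φ : ℝ → ℝ} {u : ℝ × ℝ → ℝ}
    (hu : IsViscositySolution G φ u) {c t₀ : ℝ} (hc : 0 < c) (ht₀ : 0 ≤ t₀)
    (hGG' : ∀ A, G'.eval A = c * G.eval A) (x : ℝ) :
    gNormal G' (fun y => u (t₀, x + y)) = u (t₀ + c, x) := by
  have := (hu.comp_affine (G' := G') (a := c) (b := 1) (x₀ := x) ht₀ hc one_pos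
    (by simpa using hGG')).gNormal_eq hG'
  simpa using this

theorem GFunction.sigmaHi_eq {G : GFunction} (hG : G.Nondegenerate) :
    G.sigmaHi = G.beta * G.sigmaLo := by
  have : G.sigmaLo ≠ 0 := (show 0 < G.sigmaLo from hG).ne'
  rw [GFunction.beta, div_mul_cancel₀ _ this]

theorem GFunction.one_le_beta {G : GFunction} (hG : G.Nondegenerate) : 1 ≤ G.beta :=
  (one_le_div (show 0 < G.sigmaLo from hG)).2 G.sigmaLo_le_sigmaHi

theorem gConv_comm_of_beta_eq {G₁ G₂ : GFunction} (h₁ : G₁.Nondegenerate) (h₂ : G₂.Nondegenerate)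
    (hβ : G₁.beta = G₂.beta) {φ : ℝ → ℝ} (hφ : IsBoundedLipschitz φ) :
    gConv G₁ G₂ φ = gConv G₂ G₁ φ := by
  obtain ⟨u, hu, -⟩ := exists_isViscositySolution G₁ hφ
  have l1 : 0 < G₁.sigmaLo := h₁
  have l2 : 0 < G₂.sigmaLo := h₂
  set c := (G₂.sigmaLo / G₁.sigmaLo) ^ 2
  have hc : 0 < c := by positivity
  have e1 : G₂.sigmaLo ^ 2 = c * G₁.sigmaLo ^ 2 := by simp only [c]; field_simp
  have e2 : G₂.sigmaHi ^ 2 = c * G₁.sigmaHi ^ 2 := by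
    rw [GFunction.sigmaHi_eq h₁, GFunction.sigmaHi_eq h₂, ← hβ, mul_pow, mul_pow, e1]; ring
  have hG : ∀ A, G₂.eval A = c * G₁.eval A := fun A => by
    rw [G₁.eval_eq_max, G₂.eval_eq_max, e1, e2, mul_max_of_nonneg _ _ hc.le]
    congr 1 <;> ring
  have hG1 : ∀ A, G₁.eval A = 1 * G₁.eval A := fun A => (one_mul _).symm
  have i1 : ∀ x, gNormal G₁ (fun y => φ (x + y)) = u (1, x) := fun x => by
    have := gNormal_shifted h₁ hu one_pos le_rfl hG1 x
    simpa only [hu.initial, zero_add] using this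
  have i2 : ∀ x, gNormal G₂ (fun y => φ (x + y)) = u (c, x) := fun x => by
    have := gNormal_shifted h₂ hu hc le_rfl hG x
    simpa only [hu.initial, zero_add] using this
  have o1 := gNormal_shifted h₁ hu one_pos hc.le hG1 0
  have o2 := gNormal_shifted h₂ hu hc zero_le_one hG 0
  simp only [zero_add] at o1 o2
  rw [gConv, gConv]
  simp only [i1, i2]
  rw [o1, o2, add_comm]

/-! ### Constant bounds and exponential barriers -/

theorem IsSub.le_const {F : ℝ → ℝ} {Λ C m : ℝ} {u : ℝ × ℝ → ℝ} (hF : Elliptic F Λ) (hF0 : F 0 ≤ 0)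
    (hu : IsSub F u) (huc : ContinuousOn u (Ici (0 : ℝ) ×ˢ univ))
    (hub : ∀ t x, 0 ≤ t → u (t, x) ≤ C) (h0 : ∀ x, u (0, x) ≤ m) {t x : ℝ} (ht : 0 ≤ t) :
    u (t, x) ≤ m := by
  refine hu.le_classical (T := t + 1) (C := max C (-m)) (ψ := fun _ => m) hF huc
    (fun t x ht => (hub t x ht).trans (le_max_left _ _)) continuousOn_const
    (fun t x _ _ => by linarith [le_max_right C (-m)]) (fun t x _ _ => ⟨0, 0, ?_, hF0⟩) h0 ht (by linarith)
  exact HasJet.of_time (a := fun _ => m) contDiffAt_const (hasDerivAt_const t m)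

theorem GFunction.eval_zero (G : GFunction) : G.eval 0 = 0 := by simp [G.eval_eq_max]

theorem gNormal_le {G : GFunction} (hG : G.Nondegenerate) {φ : ℝ → ℝ} (hφ : IsBoundedLipschitz φ)
    {m : ℝ} (h : ∀ x, φ x ≤ m) : gNormal G φ ≤ m := by
  obtain ⟨u, hu, -⟩ := exists_isViscositySolution G hφ
  obtain ⟨C, hC⟩ := hu.bounded
  rw [hu.gNormal_eq hG]
  exact IsSub.le_const G.elliptic G.eval_zero.le hu.subsolution hu.continuousOn
    (fun t x ht => (abs_le.1 (hC t x ht)).2) (fun x => hu.initial x ▸ h x) zero_le_one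

theorem le_gNormal {G : GFunction} (hG : G.Nondegenerate) {φ : ℝ → ℝ} (hφ : IsBoundedLipschitz φ)
    {m : ℝ} (h : ∀ x, m ≤ φ x) : m ≤ gNormal G φ := by
  obtain ⟨u, hu, -⟩ := exists_isViscositySolution G hφ
  obtain ⟨C, hC⟩ := hu.bounded
  rw [hu.gNormal_eq hG]
  have := IsSub.le_const G.elliptic.dual (by simp [dual, G.eval_zero]) hu.supersolution.isSub_dual
    hu.continuousOn.neg (C := C) (m := -m) (fun t x ht => by linarith [(abs_le.1 (hC t x ht)).1])
    (fun x => by rw [hu.initial]; linarith [h x]) (t := 1) (x := 0) zero_le_one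
  linarith

/-- Data of a `C²` function `ϕ` with `F(e ϕ'') ≤ -e (μ ϕ + θ n)` for all `e > 0`. -/
structure Decaying (F ϕ n : ℝ → ℝ) (μ θ : ℝ) : Prop where
  bounded : ∃ C, ∀ x, |ϕ x| ≤ C
  le : ∃ ϕ' ϕ'' : ℝ → ℝ, (∀ x, HasDerivAt ϕ (ϕ' x) x) ∧ (∀ x, HasDerivAt ϕ' (ϕ'' x) x) ∧
    Continuous ϕ'' ∧ ∀ e x, 0 < e → F (e * ϕ'' x) ≤ e * (-(μ * ϕ x) - θ * n x)

theorem hasDerivAt_exp_neg_mul (μ t : ℝ) :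
    HasDerivAt (fun t => Real.exp (-(μ * t))) (-(μ * Real.exp (-(μ * t)))) t := by
  have := (((hasDerivAt_id t).const_mul μ).neg).exp
  exact this.congr_deriv (by simp; ring)

/-- `e · exp(-μt) ϕ + c` is a classical supersolution: the slack `θ n` is only discarded here, and
`F` does not see the constant `c`. -/
theorem IsSub.le_exp_mul {F ϕ n : ℝ → ℝ} {Λ C μ θ e c : ℝ} {u : ℝ × ℝ → ℝ} (hF : Elliptic F Λ)
    (hu : IsSub F u) (huc : ContinuousOn u (Ici (0 : ℝ) ×ˢ univ))
    (hub : ∀ t x, 0 ≤ t → u (t, x) ≤ C) (hϕ : Decaying F ϕ n μ θ) (hμ : 0 ≤ μ) (hθ : 0 ≤ θ)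
    (hn : ∀ x, 0 ≤ n x) (he : 0 < e) (h0 : ∀ x, u (0, x) ≤ e * ϕ x + c) {t x : ℝ} (ht : 0 ≤ t) :
    u (t, x) ≤ e * Real.exp (-(μ * t)) * ϕ x + c := by
  obtain ⟨⟨B, hB⟩, ϕ', ϕ'', h1, h2, h3, h4⟩ := hϕ
  have hC2 := contDiff_two_of_hasDerivAt h1 h2 h3
  have hB0 : 0 ≤ B := (abs_nonneg _).trans (hB 0)
  refine hu.le_classical (T := t + 1) (C := max C (e * B + |c|))
    (ψ := fun z => e * Real.exp (-(μ * z.1)) * ϕ z.2 + c) hF huc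
    (fun t x ht => (hub t x ht).trans (le_max_left _ _)) ?_ ?_ ?_ ?_ ht (by linarith)
  · have := hC2.continuous
    exact Continuous.continuousOn (by fun_prop)
  · intro s y hs _
    have i1 : Real.exp (-(μ * s)) ≤ 1 := Real.exp_le_one_iff.2 (by nlinarith)
    have i2 := (abs_le.1 (hB y)).1
    have i3 : e * Real.exp (-(μ * s)) * -ϕ y ≤ e * Real.exp (-(μ * s)) * B :=
      mul_le_mul_of_nonneg_left (by linarith) (by positivity)
    have i4 : e * Real.exp (-(μ * s)) * B ≤ e * 1 * B := by gcongr
    have := neg_abs_le c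
    have := le_max_right C (e * B + |c|)
    simp only; linarith
  · intro s y _ _
    have j := HasJet.mul (a := fun s => e * Real.exp (-(μ * s))) (t := s) (x := y)
      (by fun_prop) hC2.contDiffAt ((hasDerivAt_exp_neg_mul μ s).const_mul e)
      (Eventually.of_forall h1) (h2 y)
    have j2 := HasJet.of_time (a := fun _ => c) (x := y) contDiffAt_const (hasDerivAt_const s c)
    refine ⟨_, _, j.add j2, ?_⟩
    have hpos : 0 < e * Real.exp (-(μ * s)) := by positivity
    have := h4 _ y hpos
    have : 0 ≤ e * Real.exp (-(μ * s)) * (θ * n y) :=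
      mul_nonneg hpos.le (mul_nonneg hθ (hn y))
    rw [add_zero]
    linarith
  · intro y
    simpa using h0 y

/-- If the slack `n` is positive enough where `cos x - cos (2x) / 2` is small, then subsolutions
starting below `ϕ` become uniformly negative. -/
theorem IsSub.eventually_le_neg {F ϕ n : ℝ → ℝ} {Λ m C μ θ : ℝ} {u : ℝ × ℝ → ℝ}
    (hF : Elliptic F Λ) (hm : 0 < m) (hFm : ∀ a b, 0 ≤ b → F a + m * b ≤ F (a + b))
    (hu : IsSub F u) (huc : ContinuousOn u (Ici (0 : ℝ) ×ˢ univ))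
    (hub : ∀ t x, 0 ≤ t → u (t, x) ≤ C) (hϕ : Decaying F ϕ n μ θ) (hμ : 0 < μ) (hθ : 0 < θ)
    (hn : ∀ x, 0 ≤ n x)
    (hcos : ∀ x, 1 / 2 - 2 * n x ≤ Real.cos x - Real.cos (2 * x) / 2)
    (h0 : ∀ x, u (0, x) ≤ ϕ x) :
    ∃ δ > 0, ∀ᶠ t in atTop, ∀ x, u (t, x) ≤ -δ := by
  obtain ⟨⟨B, hB⟩, ϕ', ϕ'', h1, h2, h3, h4⟩ := id hϕ
  have hC2 := contDiff_two_of_hasDerivAt h1 h2 h3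
  have hB0 : 0 ≤ B := (abs_nonneg _).trans (hB 0)
  have hΛ := hF.nonneg
  have hmono : ∀ a b, a ≤ b → F a ≤ F b := fun a b hab => by
    have := hF.mono a (b - a) (by linarith)
    rwa [add_sub_cancel] at this
  -- `g'' = cos x - cos(2x)/2` is at least `1/2` where `n = 0`. Adding `-ε g` thus lowers the second
  -- derivative there, and elsewhere the slack `θ n` absorbs the possible increase; the gain lets
  -- the barrier sink at speed `ε m / 2`.
  let g : ℝ → ℝ := fun x => -Real.cos x + Real.cos (2 * x) / 8
  have hg1 : ∀ x, HasDerivAt g (Real.sin x - Real.sin (2 * x) / 4) x := fun x => by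
    have := (Real.hasDerivAt_cos x).neg.add
      ((((hasDerivAt_id x).const_mul 2).cos).div_const 8)
    exact this.congr_deriv (by simp; ring)
  have hg2 : ∀ x, HasDerivAt (fun x => Real.sin x - Real.sin (2 * x) / 4)
      (Real.cos x - Real.cos (2 * x) / 2) x := fun x => by
    have := (Real.hasDerivAt_sin x).sub ((((hasDerivAt_id x).const_mul 2).sin).div_const 4)
    exact this.congr_deriv (by simp; ring)
  have hgb : ∀ x, -2 ≤ g x ∧ g x ≤ 2 := fun x => by
    have := Real.cos_le_one x
    have := Real.neg_one_le_cos x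
    have := Real.cos_le_one (2 * x)
    have := Real.neg_one_le_cos (2 * x)
    simp only [g]; constructor <;> linarith
  -- By time `T` the barrier has sunk by `5ε`, so `-ε g + ε(2 - 5) ≤ -ε` in view of `|g| ≤ 2`.
  let T := 10 / m
  have hT : 0 < T := by positivity
  -- Small enough that `2Λε ≤ θ exp(-μs)` up to time `T + 1`, the horizon of the comparison.
  let ε := Real.exp (-(μ * (T + 1))) * θ / (2 * Λ + 1)
  have hε : 0 < ε := by positivity
  have hmT : m / 2 * T = 5 := by simp only [T]; field_simp; norm_num
  have hstepone : ∀ x, u (T, x) ≤ Real.exp (-(μ * T)) * ϕ x - ε := by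
    intro x
    have key := hu.le_classical (T := T + 1) (C := max C (B + ε * (5 + m)))
      (ψ := fun z => Real.exp (-(μ * z.1)) * ϕ z.2 + (-(ε * g z.2) + ε * (2 - m / 2 * z.1))) hF huc
      (fun t x ht => (hub t x ht).trans (le_max_left _ _)) ?_ ?_ ?_ ?_ (t := T) (x := x)
      hT.le (by linarith)
    · have := (hgb x).1
      rw [hmT] at key
      nlinarith
    · have := hC2.continuous
      refine Continuous.continuousOn ?_
      simp only [g]
      fun_prop
    · intro s y hs hsT
      have i1 : Real.exp (-(μ * s)) ≤ 1 := Real.exp_le_one_iff.2 (by nlinarith)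
      have i2 := (abs_le.1 (hB y)).1
      have i3 : Real.exp (-(μ * s)) * -ϕ y ≤ Real.exp (-(μ * s)) * B :=
        mul_le_mul_of_nonneg_left (by linarith) (by positivity)
      have i4 : Real.exp (-(μ * s)) * B ≤ 1 * B := by gcongr
      have i5 : ε * (g y + (-2 + m / 2 * s)) ≤ ε * (5 + m) := by
        have : m / 2 * s ≤ m / 2 * (T + 1) := by gcongr
        exact mul_le_mul_of_nonneg_left (by linarith [(hgb y).2]) hε.le
      have := le_max_right C (B + ε * (5 + m))
      simp only; linarith
    · intro s y hs hsT
      have j := HasJet.mul (a := fun s => Real.exp (-(μ * s))) (t := s) (x := y)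
        (by fun_prop) hC2.contDiffAt (hasDerivAt_exp_neg_mul μ s) (Eventually.of_forall h1) (h2 y)
      have j1 : HasJet (fun z => -(ε * g z.2)) s y 0
          (-(ε * (Real.cos y - Real.cos (2 * y) / 2))) :=
        HasJet.of_space (f := fun y => -(ε * g y)) (by simp only [g]; fun_prop)
          (Eventually.of_forall fun y => ((hg1 y).const_mul ε).neg) ((hg2 y).const_mul ε).neg
      have j2 : HasJet (fun z => ε * (2 - m / 2 * z.1)) s y (ε * -(m / 2)) 0 :=
        HasJet.of_time (a := fun r => ε * (2 - m / 2 * r)) (by fun_prop)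
          (by simpa using (((hasDerivAt_id s).const_mul (m / 2)).const_sub 2).const_mul ε)
      refine ⟨_, _, j.add (j1.add j2), ?_⟩
      set e := Real.exp (-(μ * s))
      have he : 0 < e := Real.exp_pos _
      have hee : Real.exp (-(μ * (T + 1))) ≤ e := Real.exp_le_exp.2 (by nlinarith)
      have hεe : 2 * Λ * ε ≤ e * θ := by
        have : (2 * Λ + 1) * ε = Real.exp (-(μ * (T + 1))) * θ := by simp only [ε]; field_simp
        have : Real.exp (-(μ * (T + 1))) * θ ≤ e * θ := by gcongr
        linarith
      have k1 := mul_le_mul_of_nonneg_left (hcos y) hε.le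
      have k2 := mul_nonneg hε.le (hn y)
      have k3 := hmono (e * ϕ'' y + (-(ε * (Real.cos y - Real.cos (2 * y) / 2)) + 0))
        (e * ϕ'' y - ε / 2 + 2 * (ε * n y)) (by linarith)
      have k4 := hF.le (e * ϕ'' y - ε / 2) (2 * (ε * n y)) (by linarith)
      have k5 := hFm (e * ϕ'' y - ε / 2) (ε / 2) (by linarith)
      rw [sub_add_cancel] at k5
      have k6 := h4 e y he
      have k7 := mul_le_mul_of_nonneg_right hεe (hn y)
      linarith
    · intro y
      have := h0 y
      have : 0 ≤ ε * (2 - g y) := mul_nonneg hε.le (by linarith [(hgb y).2])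
      simp only [mul_zero, neg_zero, Real.exp_zero, sub_zero, one_mul]
      linarith
  -- Restarting at `T`, the `ϕ` part keeps decaying while the constant `-ε` survives.
  have hsteptwo : ∀ s x, 0 ≤ s → u (T + s, x) ≤ Real.exp (-(μ * T)) * Real.exp (-(μ * s)) * ϕ x - ε := by
    intro s x hs
    have hu' := hu.comp_affine (F' := F) hT.le one_pos one_pos (x₀ := 0) (by intro A; simp)
    have := hu'.le_exp_mul (c := -ε) hF (continuousOn_shift huc hT.le zero_le_one)
      (fun t x ht => hub _ _ (by positivity)) hϕ hμ.le hθ.le hn (Real.exp_pos (-(μ * T)))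
      (fun x => by simpa [← sub_eq_add_neg] using hstepone x) (t := s) (x := x) hs
    simpa [← sub_eq_add_neg] using this
  refine ⟨ε / 2, by linarith, ?_⟩
  have hlim : Tendsto (fun t : ℝ => Real.exp (-(μ * t)) * B) atTop (𝓝 (0 * B)) :=
    (Real.tendsto_exp_neg_atTop_nhds_zero.comp (tendsto_id.const_mul_atTop hμ)).mul_const B
  rw [zero_mul] at hlim
  filter_upwards [hlim.eventually (gt_mem_nhds (half_pos hε)), eventually_ge_atTop T] with t ht htT x
  have h5 := hsteptwo (t - T) x (by linarith)
  rw [add_sub_cancel, ← Real.exp_add, show -(μ * T) + -(μ * (t - T)) = -(μ * t) by ring] at h5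
  have h6 : Real.exp (-(μ * t)) * ϕ x ≤ Real.exp (-(μ * t)) * B :=
    mul_le_mul_of_nonneg_left (abs_le.1 (hB x)).2 (Real.exp_pos _).le
  linarith

/-! ### Gluing of periodic functions and the calculus of `phi` -/

theorem hasDerivAt_of_left_right {f l r : ℝ → ℝ} {d y : ℝ} (hl : HasDerivAt l d y)
    (hr : HasDerivAt r d y) (hfl : ∀ᶠ z in 𝓝[<] y, f z = l z) (hfr : ∀ᶠ z in 𝓝[>] y, f z = r z)
    (hyl : f y = l y) (hyr : f y = r y) : HasDerivAt f d y := by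
  have h1 : HasDerivWithinAt f d (Iio y) y := hl.hasDerivWithinAt.congr_of_eventuallyEq hfl hyl
  have h2 : HasDerivWithinAt f d (Ioi y) y := hr.hasDerivWithinAt.congr_of_eventuallyEq hfr hyr
  have h3 := h1.Iic_of_Iio.union h2.Ici_of_Ioi
  rwa [Iic_union_Ici, hasDerivWithinAt_univ] at h3

/-- The `2π`-periodic function equal to `p₁` on `[-a, a)` and to `p₂` on `[a, 2π - a)`. -/
noncomputable def glue (a : ℝ) (p₁ p₂ : ℝ → ℝ) (x : ℝ) : ℝ :=
  if toIcoMod Real.two_pi_pos (-a) x < a then p₁ (toIcoMod Real.two_pi_pos (-a) x)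
  else p₂ (toIcoMod Real.two_pi_pos (-a) x)

theorem glue_of_mem {a z : ℝ} (p₁ p₂ : ℝ → ℝ) (hz : z ∈ Ico (-a) (2 * Real.pi - a)) :
    glue a p₁ p₂ z = if z < a then p₁ z else p₂ z := by
  have : toIcoMod Real.two_pi_pos (-a) z = z :=
    (toIcoMod_eq_self _).2 ⟨hz.1, by linarith [hz.2]⟩
  simp only [glue, this]

theorem glue_sub_zsmul (a : ℝ) (p₁ p₂ : ℝ → ℝ) (x : ℝ) (n : ℤ) :
    glue a p₁ p₂ (x - n • (2 * Real.pi)) = glue a p₁ p₂ x := by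
  simp only [glue, toIcoMod_sub_zsmul]

theorem glue_add_two_pi (a : ℝ) (p₁ p₂ : ℝ → ℝ) (x : ℝ) :
    glue a p₁ p₂ (x + 2 * Real.pi) = glue a p₁ p₂ x := by
  simp only [glue, toIcoMod_add_right]

theorem hasDerivAt_glue {a : ℝ} {p₁ p₂ q₁ q₂ : ℝ → ℝ} (ha : 0 < a) (haπ : a < Real.pi)
    (h₁ : ∀ x, HasDerivAt p₁ (q₁ x) x) (h₂ : ∀ x, HasDerivAt p₂ (q₂ x) x)
    (hp : p₁ a = p₂ a) (hq : q₁ a = q₂ a) (hp' : p₁ (-a) = p₂ (2 * Real.pi - a))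
    (hq' : q₁ (-a) = q₂ (2 * Real.pi - a)) (x : ℝ) :
    HasDerivAt (glue a p₁ p₂) (glue a q₁ q₂ x) x := by
  suffices H : ∀ y ∈ Ico (-a) (2 * Real.pi - a), HasDerivAt (glue a p₁ p₂) (glue a q₁ q₂ y) y by
    set y := toIcoMod Real.two_pi_pos (-a) x
    have hy : y ∈ Ico (-a) (2 * Real.pi - a) := by
      have := toIcoMod_mem_Ico Real.two_pi_pos (-a) x
      exact ⟨this.1, by linarith [this.2]⟩
    have hxy : x - toIcoDiv Real.two_pi_pos (-a) x • (2 * Real.pi) = y :=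
      self_sub_toIcoDiv_zsmul Real.two_pi_pos (-a) x
    have h := H y hy
    rw [← hxy, glue_sub_zsmul] at h
    have h' := h.comp_sub_const x (toIcoDiv Real.two_pi_pos (-a) x • (2 * Real.pi))
    simpa only [glue_sub_zsmul] using h'
  intro y hy
  have hleft : ∀ z ∈ Ico (-a) a, glue a p₁ p₂ z = p₁ z := fun z hz => by
    rw [glue_of_mem _ _ ⟨hz.1, by linarith [hz.2]⟩, if_pos hz.2]
  have hright : ∀ z ∈ Ico a (2 * Real.pi - a), glue a p₁ p₂ z = p₂ z := fun z hz => by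
    rw [glue_of_mem _ _ ⟨by linarith [hz.1], hz.2⟩, if_neg (not_lt.2 hz.1)]
  rw [glue_of_mem q₁ q₂ hy]
  rcases lt_trichotomy y a with h | h | h
  · rw [if_pos h]
    rcases hy.1.eq_or_lt with h' | h'
    · subst h'
      -- Just left of `-a` the periodic function is `p₂` moved by one period.
      refine hasDerivAt_of_left_right (l := fun z => p₂ (z + 2 * Real.pi)) (r := p₁) ?_ (h₁ _) ?_ ?_ ?_ ?_
      · rw [hq', show 2 * Real.pi - a = -a + 2 * Real.pi by ring]
        exact (h₂ _).comp_add_const _ _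
      · filter_upwards [Ioo_mem_nhdsLT (show a - 2 * Real.pi < -a by linarith)] with z hz
        rw [← glue_add_two_pi]
        exact hright _ ⟨by linarith [hz.1], by linarith [hz.2]⟩
      · filter_upwards [Ioo_mem_nhdsGT (show -a < a by linarith)] with z hz
        exact hleft z ⟨hz.1.le, hz.2⟩
      · rw [hleft _ ⟨le_rfl, by linarith⟩, hp']; ring_nf
      · exact hleft _ ⟨le_rfl, by linarith⟩
    · refine (h₁ y).congr_of_eventuallyEq ?_
      filter_upwards [Ioo_mem_nhds h' h] with z hz
      exact hleft z ⟨hz.1.le, hz.2⟩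
  · subst h
    rw [if_neg (lt_irrefl _)]
    refine hasDerivAt_of_left_right (hq ▸ h₁ y) (h₂ y) ?_ ?_ ?_ ?_
    · filter_upwards [Ioo_mem_nhdsLT (show -y < y by linarith)] with z hz
      exact hleft z ⟨hz.1.le, hz.2⟩
    · filter_upwards [Ioo_mem_nhdsGT (show y < 2 * Real.pi - y by linarith)] with z hz
      exact hright z ⟨hz.1.le, hz.2⟩
    · rw [hright y ⟨le_rfl, by linarith⟩, hp]
    · exact hright y ⟨le_rfl, by linarith⟩
  · rw [if_neg (not_lt.2 h.le)]
    refine (h₂ y).congr_of_eventuallyEq ?_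
    filter_upwards [Ioo_mem_nhds h hy.2] with z hz
    exact hright z ⟨hz.1.le, hz.2⟩

section phi

variable {β : ℝ}

theorem phi_eq_glue (β : ℝ) : phi β = glue (Real.pi / (1 + β))
    (fun y => 2 / (1 + β) * Real.cos ((1 + β) / 2 * y))
    (fun y => 2 * β / (1 + β) * Real.cos ((1 + β) / (2 * β) * y + (β - 1) / (2 * β) * Real.pi)) :=
  rfl

/-- The derivative of `phi β`. -/
noncomputable def phiDeriv (β : ℝ) : ℝ → ℝ := glue (Real.pi / (1 + β))
    (fun y => -Real.sin ((1 + β) / 2 * y))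
    (fun y => -Real.sin ((1 + β) / (2 * β) * y + (β - 1) / (2 * β) * Real.pi))

theorem phi_angle_left (hβ : 1 ≤ β) : (1 + β) / 2 * (Real.pi / (1 + β)) = Real.pi / 2 := by
  field_simp

theorem phi_angle_mid (hβ : 1 ≤ β) :
    (1 + β) / (2 * β) * (Real.pi / (1 + β)) + (β - 1) / (2 * β) * Real.pi = Real.pi / 2 := by
  field_simp; ring

theorem phi_angle_right (hβ : 1 ≤ β) :
    (1 + β) / (2 * β) * (2 * Real.pi - Real.pi / (1 + β)) + (β - 1) / (2 * β) * Real.pi =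
      Real.pi / 2 + Real.pi := by
  field_simp; ring

theorem phi_break_pos (hβ : 1 ≤ β) : 0 < Real.pi / (1 + β) := by
  have := Real.pi_pos; positivity

theorem phi_break_le (hβ : 1 ≤ β) : Real.pi / (1 + β) ≤ Real.pi / 2 :=
  div_le_div_of_nonneg_left Real.pi_pos.le two_pos (by linarith)

theorem phi_break_lt (hβ : 1 ≤ β) : Real.pi / (1 + β) < Real.pi := by
  linarith [phi_break_le hβ, Real.pi_pos]

theorem hasDerivAt_phi (hβ : 1 ≤ β) (x : ℝ) : HasDerivAt (phi β) (phiDeriv β x) x := by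
  rw [phi_eq_glue, phiDeriv]
  refine hasDerivAt_glue (phi_break_pos hβ) (phi_break_lt hβ) (fun y => ?_) (fun y => ?_) ?_ ?_ ?_ ?_ x
  · refine ((((hasDerivAt_id y).const_mul ((1 + β) / 2)).cos).const_mul _).congr_deriv ?_
    simp; field_simp
  · refine (((((hasDerivAt_id y).const_mul ((1 + β) / (2 * β))).add_const
      ((β - 1) / (2 * β) * Real.pi)).cos).const_mul _).congr_deriv ?_
    simp; field_simp
  all_goals simp only [mul_neg, phi_angle_left hβ, phi_angle_mid hβ, phi_angle_right hβ,
    Real.cos_neg, Real.sin_neg, Real.cos_add_pi, Real.sin_add_pi, Real.cos_pi_div_two,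
    Real.sin_pi_div_two, mul_zero, neg_zero]

/-- The second derivative of `phi β`, expressed through the positive and negative parts. -/
noncomputable def phiSecond (β x : ℝ) : ℝ :=
  -(((1 + β) / 2) ^ 2 * max (phi β x) 0) + ((1 + β) / (2 * β)) ^ 2 * max (-phi β x) 0

/-- Reduces `x` to the fundamental interval and records the sign of the relevant cosine: `phi` is
nonnegative on the first arc and nonpositive on the second. -/
theorem phi_cases (hβ : 1 ≤ β) (x : ℝ) :
    ∃ y, Real.cos x = Real.cos y ∧
      ((toIcoMod Real.two_pi_pos (-(Real.pi / (1 + β))) x = y ∧ y < Real.pi / (1 + β) ∧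
        -(Real.pi / (1 + β)) ≤ y ∧ 0 ≤ Real.cos ((1 + β) / 2 * y)) ∨
      (toIcoMod Real.two_pi_pos (-(Real.pi / (1 + β))) x = y ∧ Real.pi / (1 + β) ≤ y ∧
        y < 2 * Real.pi - Real.pi / (1 + β) ∧
        Real.cos ((1 + β) / (2 * β) * y + (β - 1) / (2 * β) * Real.pi) ≤ 0)) := by
  set a := Real.pi / (1 + β)
  have hm := toIcoMod_mem_Ico Real.two_pi_pos (-a) x
  have hxy : x - toIcoDiv Real.two_pi_pos (-a) x • (2 * Real.pi) =
      toIcoMod Real.two_pi_pos (-a) x := self_sub_toIcoDiv_zsmul Real.two_pi_pos (-a) x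
  refine ⟨toIcoMod Real.two_pi_pos (-a) x, ?_, ?_⟩
  · rw [← hxy, zsmul_eq_mul, Real.cos_sub_int_mul_two_pi]
  set y := toIcoMod Real.two_pi_pos (-a) x
  rcases lt_or_ge y a with hy | hy
  · refine Or.inl ⟨rfl, hy, hm.1, Real.cos_nonneg_of_neg_pi_div_two_le_of_le ?_ ?_⟩
    · have := mul_le_mul_of_nonneg_left hm.1 (by positivity : 0 ≤ (1 + β) / 2)
      rw [mul_neg, phi_angle_left hβ] at this
      linarith
    · have := mul_le_mul_of_nonneg_left hy.le (by positivity : 0 ≤ (1 + β) / 2)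
      rw [phi_angle_left hβ] at this
      linarith
  · have hk : 0 ≤ (1 + β) / (2 * β) := by positivity
    have hy2 : y < 2 * Real.pi - a := by linarith [hm.2]
    refine Or.inr ⟨rfl, hy, hy2, Real.cos_nonpos_of_pi_div_two_le_of_le ?_ ?_⟩
    · have := mul_le_mul_of_nonneg_left hy hk
      linarith [phi_angle_mid hβ]
    · have := mul_le_mul_of_nonneg_left hy2.le hk
      linarith [phi_angle_right hβ]

/-- Written through the parts of `phi`, the second derivative is visibly continuous and its sign,
which decides the branch of `G`, is visibly opposite to that of `phi`. -/
theorem glue_eq_phiSecond (hβ : 1 ≤ β) (x : ℝ) : glue (Real.pi / (1 + β))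
    (fun y => -((1 + β) / 2 * Real.cos ((1 + β) / 2 * y)))
    (fun y => -((1 + β) / (2 * β) *
      Real.cos ((1 + β) / (2 * β) * y + (β - 1) / (2 * β) * Real.pi))) x = phiSecond β x := by
  obtain ⟨y, -, ⟨hy, hy1, -, hc⟩ | ⟨hy, hy1, -, hc⟩⟩ := phi_cases hβ x
  · have hphi : phi β x = 2 / (1 + β) * Real.cos ((1 + β) / 2 * y) := by
      simp only [phi_eq_glue, glue, hy, if_pos hy1]
    have h0 : 0 ≤ phi β x := by rw [hphi]; positivity
    simp only [glue, hy, if_pos hy1, phiSecond]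
    rw [max_eq_left h0, max_eq_right (by linarith), hphi]
    field_simp
    ring
  · have hphi : phi β x = 2 * β / (1 + β) *
        Real.cos ((1 + β) / (2 * β) * y + (β - 1) / (2 * β) * Real.pi) := by
      simp only [phi_eq_glue, glue, hy, if_neg (not_lt.2 hy1)]
    have h0 : phi β x ≤ 0 := by
      rw [hphi]; exact mul_nonpos_of_nonneg_of_nonpos (by positivity) hc
    simp only [glue, hy, if_neg (not_lt.2 hy1), phiSecond]
    rw [max_eq_right h0, max_eq_left (by linarith), hphi]
    generalize Real.cos _ = w
    field_simp
    ring

theorem hasDerivAt_phiDeriv (hβ : 1 ≤ β) (x : ℝ) : HasDerivAt (phiDeriv β) (phiSecond β x) x := by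
  rw [phiDeriv, ← glue_eq_phiSecond hβ]
  refine hasDerivAt_glue (phi_break_pos hβ) (phi_break_lt hβ) (fun y => ?_) (fun y => ?_) ?_ ?_ ?_ ?_ x
  · refine ((((hasDerivAt_id y).const_mul ((1 + β) / 2)).sin).neg).congr_deriv ?_
    simp; ring
  · refine (((((hasDerivAt_id y).const_mul ((1 + β) / (2 * β))).add_const
      ((β - 1) / (2 * β) * Real.pi)).sin).neg).congr_deriv ?_
    simp; ring
  all_goals simp only [mul_neg, phi_angle_left hβ, phi_angle_mid hβ, phi_angle_right hβ,
    Real.cos_neg, Real.sin_neg, Real.cos_add_pi, Real.sin_add_pi, Real.cos_pi_div_two,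
    Real.sin_pi_div_two, mul_zero, neg_zero]

theorem continuous_phi (hβ : 1 ≤ β) : Continuous (phi β) :=
  continuous_iff_continuousAt.2 fun x => (hasDerivAt_phi hβ x).continuousAt

theorem continuous_phiSecond (hβ : 1 ≤ β) : Continuous (phiSecond β) := by
  have := continuous_phi hβ
  unfold phiSecond; fun_prop

theorem abs_phi_le (hβ : 1 ≤ β) (x : ℝ) : |phi β x| ≤ 2 := by
  have hle : ∀ c w : ℝ, 0 ≤ c → c ≤ 2 → |c * Real.cos w| ≤ 2 := fun c w h0 h2 => by
    rw [abs_mul, abs_of_nonneg h0]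
    nlinarith [Real.abs_cos_le_one w, abs_nonneg (Real.cos w)]
  simp only [phi_eq_glue, glue]
  split_ifs
  · exact hle _ _ (by positivity) (by rw [div_le_iff₀ (by positivity)]; linarith)
  · exact hle _ _ (by positivity) (by rw [div_le_iff₀ (by positivity)]; linarith)

theorem abs_phiDeriv_le (β x : ℝ) : |phiDeriv β x| ≤ 1 := by
  simp only [phiDeriv, glue]
  split_ifs <;> rw [abs_neg] <;> exact Real.abs_sin_le_one _

theorem isBoundedLipschitz_phi (hβ : 1 ≤ β) : IsBoundedLipschitz (phi β) := by
  refine ⟨⟨2, abs_phi_le hβ⟩, 1, ?_⟩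
  refine lipschitzWith_of_nnnorm_deriv_le (fun x => (hasDerivAt_phi hβ x).differentiableAt) fun x => ?_
  rw [(hasDerivAt_phi hβ x).deriv, ← NNReal.coe_le_coe, coe_nnnorm, Real.norm_eq_abs]
  exact abs_phiDeriv_le β x

/-- The right side is `1/2 + cos x (1 - cos x)`, so only `cos x < 0` matters, and there `-cos x ≤
-phi β x` suffices. Such `x` lie on the second arc, where `-phi`, centred at `π`, is a cosine of
amplitude at least 1 and frequency at most 1. -/
theorem cos_sub_ge_of_phi (hβ : 1 ≤ β) (x : ℝ) :
    1 / 2 - 2 * max (-phi β x) 0 ≤ Real.cos x - Real.cos (2 * x) / 2 := by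
  have hn := le_max_right (-phi β x) 0
  have hn' := le_max_left (-phi β x) 0
  rw [Real.cos_two_mul]
  suffices H : 0 ≤ Real.cos x ∨ -Real.cos x ≤ -phi β x by
    have h1 := Real.cos_le_one x
    have h2 := Real.neg_one_le_cos x
    rcases le_total 0 (Real.cos x) with h0 | h0
    · nlinarith
    · rcases H with H | H <;> nlinarith
  obtain ⟨y, hxy, ⟨hy, hy1, hy2, hc⟩ | ⟨hy, hy1, hy2, hc⟩⟩ := phi_cases hβ x
  · left
    rw [hxy]
    have := phi_break_le hβ
    exact Real.cos_nonneg_of_neg_pi_div_two_le_of_le (by linarith) (by linarith)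
  · rcases le_or_gt 0 (Real.cos y) with h | h
    · exact Or.inl (hxy ▸ h)
    right
    have hphi : phi β x = 2 * β / (1 + β) *
        Real.cos ((1 + β) / (2 * β) * y + (β - 1) / (2 * β) * Real.pi) := by
      simp only [phi_eq_glue, glue, hy, if_neg (not_lt.2 hy1)]
    have hang : (1 + β) / (2 * β) * y + (β - 1) / (2 * β) * Real.pi =
        (1 + β) / (2 * β) * (y - Real.pi) + Real.pi := by field_simp; ring
    have hcos : Real.cos y = -Real.cos (y - Real.pi) := by rw [Real.cos_sub_pi]; ring
    rw [hphi, hang, Real.cos_add_pi, hxy, hcos, mul_neg, neg_neg, neg_neg]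
    set w := y - Real.pi
    have hk0 : 0 ≤ (1 + β) / (2 * β) := by positivity
    have hk1 : (1 + β) / (2 * β) ≤ 1 := by rw [div_le_one (by positivity)]; linarith
    have hk2 : 1 ≤ 2 * β / (1 + β) := by rw [one_le_div (by positivity)]; linarith
    have hw : |w| ≤ Real.pi := by
      have := phi_break_pos hβ
      rw [abs_le]; simp only [w]; constructor <;> linarith
    have h1 : Real.cos w ≤ Real.cos ((1 + β) / (2 * β) * w) := by
      rw [← Real.cos_abs w, ← Real.cos_abs (_ * w), abs_mul, abs_of_nonneg hk0]
      exact Real.cos_le_cos_of_nonneg_of_le_pi (by positivity) hw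
        (mul_le_of_le_one_left (abs_nonneg w) hk1)
    have h2 : 0 < Real.cos w := by linarith
    nlinarith

end phi

/-! ### Evolution of `phi` under the `G`-heat flow -/

theorem eval_mul_phiSecond (G : GFunction) {β e : ℝ} (he : 0 ≤ e) (x : ℝ) :
    G.eval (e * phiSecond β x) = e * (G.sigmaHi ^ 2 / 2 * (((1 + β) / (2 * β)) ^ 2 *
      max (-phi β x) 0) - G.sigmaLo ^ 2 / 2 * (((1 + β) / 2) ^ 2 * max (phi β x) 0)) := by
  rw [G.eval_mul he]
  congr 1
  simp only [GFunction.eval, phiSecond]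
  rcases le_total 0 (phi β x) with h | h
  · have h1 : 0 ≤ ((1 + β) / 2) ^ 2 * phi β x := by positivity
    rw [max_eq_right (by linarith : -phi β x ≤ 0), max_eq_left h, mul_zero, add_zero, neg_neg,
      max_eq_right (by linarith), max_eq_left h1]
    ring
  · have h1 : 0 ≤ ((1 + β) / (2 * β)) ^ 2 * -phi β x := mul_nonneg (sq_nonneg _) (by linarith)
    rw [max_eq_left (by linarith : 0 ≤ -phi β x), max_eq_right h, mul_zero, neg_zero, zero_add,
      max_eq_left h1, max_eq_right (by linarith)]
    ring

theorem max_sub_max_neg (a : ℝ) : max a 0 - max (-a) 0 = a := by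
  rcases le_total 0 a with h | h
  · rw [max_eq_left h, max_eq_right (by linarith)]; ring
  · rw [max_eq_right h, max_eq_left (by linarith)]; ring

/-- The decay rate of `phi β` under the `G`-heat flow with `β = G.beta`. -/
noncomputable def rate (G : GFunction) (β : ℝ) : ℝ := G.sigmaLo ^ 2 / 2 * ((1 + β) / 2) ^ 2

theorem rate_pos {G : GFunction} (hG : G.Nondegenerate) {β : ℝ} (hβ : 1 ≤ β) : 0 < rate G β := by
  have : 0 < G.sigmaLo := hG
  unfold rate; positivity

/-- The left side is the decay rate on the negative arc; it differs from the rate on the positive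
arc by the factor `(β_G / β)²`. -/
theorem sigmaHi_sq_mul {G : GFunction} (hG : G.Nondegenerate) {β : ℝ} (hβ : 1 ≤ β) :
    G.sigmaHi ^ 2 / 2 * ((1 + β) / (2 * β)) ^ 2 = rate G β * (G.beta / β) ^ 2 := by
  rw [GFunction.sigmaHi_eq hG, rate]
  field_simp

/-- The inequality is in fact an equality. The slack coefficient is positive for `β_G < β` and zero
for `β_G = β`, when `phi β` is an eigenfunction of `G(∂ₓ²)`. -/
theorem decaying_phi {G : GFunction} (hG : G.Nondegenerate) {β : ℝ} (hβ : 1 ≤ β) :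
    Decaying G.eval (phi β) (fun x => max (-phi β x) 0) (rate G β)
      (rate G β * (1 - (G.beta / β) ^ 2)) := by
  refine ⟨⟨2, abs_phi_le hβ⟩, phiDeriv β, phiSecond β, hasDerivAt_phi hβ, hasDerivAt_phiDeriv hβ,
    continuous_phiSecond hβ, fun e x he => ?_⟩
  rw [eval_mul_phiSecond G he.le, ← mul_assoc (G.sigmaHi ^ 2 / 2), sigmaHi_sq_mul hG hβ,
    ← mul_assoc (G.sigmaLo ^ 2 / 2)]
  change e * (_ - rate G β * _) ≤ _
  refine le_of_eq ?_
  nth_rewrite 3 [← max_sub_max_neg (phi β x)]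
  ring

/-- Mirror image for the lower barrier: passing to `-phi` and `dual` flips the sign of the slack,
which is now positive for `β < β_G`. -/
theorem decaying_neg_phi {G : GFunction} (hG : G.Nondegenerate) {β : ℝ} (hβ : 1 ≤ β) :
    Decaying (dual G.eval) (fun x => -phi β x) (fun x => max (-phi β x) 0) (rate G β)
      (rate G β * ((G.beta / β) ^ 2 - 1)) := by
  refine ⟨⟨2, fun x => by rw [abs_neg]; exact abs_phi_le hβ x⟩, fun x => -phiDeriv β x,
    fun x => -phiSecond β x, fun x => (hasDerivAt_phi hβ x).neg,
    fun x => (hasDerivAt_phiDeriv hβ x).neg, (continuous_phiSecond hβ).neg, fun e x he => ?_⟩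
  rw [dual, mul_neg, neg_neg, eval_mul_phiSecond G he.le, ← mul_assoc (G.sigmaHi ^ 2 / 2),
    sigmaHi_sq_mul hG hβ, ← mul_assoc (G.sigmaLo ^ 2 / 2)]
  change -(e * (_ - rate G β * _)) ≤ _
  refine le_of_eq ?_
  nth_rewrite 3 [← max_sub_max_neg (phi β x)]
  ring

/-- Uniform ellipticity; with `σlo > 0` it is the source of the sinking speed in
`IsSub.eventually_le_neg`. -/
theorem GFunction.strict (G : GFunction) (a : ℝ) {b : ℝ} (hb : 0 ≤ b) :
    G.eval a + G.sigmaLo ^ 2 / 2 * b ≤ G.eval (a + b) := by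
  have := mul_le_mul_of_nonneg_right G.sq_le hb
  rw [G.eval_eq_max, G.eval_eq_max, ← max_add_add_right]
  exact max_le_max (by linarith) (by linarith)

theorem GFunction.dual_strict (G : GFunction) (a : ℝ) {b : ℝ} (hb : 0 ≤ b) :
    dual G.eval a + G.sigmaLo ^ 2 / 2 * b ≤ dual G.eval (a + b) := by
  have := G.strict (-(a + b)) hb
  rw [show -(a + b) + b = -a by ring] at this
  simp only [dual]; linarith

/-- For `β_G < β` the `G`-heat flow started at `phi β` becomes uniformly negative. -/
theorem eventually_le_neg_of_beta_lt {G : GFunction} (hG : G.Nondegenerate) {β : ℝ} (hβ : 1 ≤ β)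
    (hlt : G.beta < β) {u : ℝ × ℝ → ℝ} (hu : IsViscositySolution G (phi β) u) :
    ∃ δ > 0, ∀ᶠ t in atTop, ∀ x, u (t, x) ≤ -δ := by
  have hlo : 0 < G.sigmaLo := hG
  obtain ⟨C, hC⟩ := hu.bounded
  have h1 : G.beta / β < 1 := (div_lt_one (by linarith)).2 hlt
  have h0 : 0 < G.beta / β := div_pos (by linarith [GFunction.one_le_beta hG]) (by linarith)
  exact IsSub.eventually_le_neg G.elliptic (m := G.sigmaLo ^ 2 / 2) (by positivity)
    (fun a b hb => G.strict a hb) hu.subsolution hu.continuousOn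
    (fun t x ht => (abs_le.1 (hC t x ht)).2) (decaying_phi hG hβ) (rate_pos hG hβ)
    (mul_pos (rate_pos hG hβ) (by nlinarith)) (fun x => le_max_right _ _)
    (cos_sub_ge_of_phi hβ) (fun x => (hu.initial x).le)

/-- For `β < β_G` the `G`-heat flow started at `phi β` becomes uniformly positive. -/
theorem eventually_ge_of_lt_beta {G : GFunction} (hG : G.Nondegenerate) {β : ℝ} (hβ : 1 ≤ β)
    (hlt : β < G.beta) {u : ℝ × ℝ → ℝ} (hu : IsViscositySolution G (phi β) u) :
    ∃ δ > 0, ∀ᶠ t in atTop, ∀ x, δ ≤ u (t, x) := by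
  have hlo : 0 < G.sigmaLo := hG
  obtain ⟨C, hC⟩ := hu.bounded
  have h1 : 1 < G.beta / β := (one_lt_div (by linarith)).2 hlt
  obtain ⟨δ, hδ, h⟩ := IsSub.eventually_le_neg (u := fun z => -u z) (C := C) G.elliptic.dual
    (m := G.sigmaLo ^ 2 / 2) (by positivity)
    (fun a b hb => G.dual_strict a hb) hu.supersolution.isSub_dual hu.continuousOn.neg
    (fun t x ht => by linarith [(abs_le.1 (hC t x ht)).1]) (decaying_neg_phi hG hβ) (rate_pos hG hβ)
    (mul_pos (rate_pos hG hβ) (by nlinarith)) (fun x => le_max_right _ _)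
    (cos_sub_ge_of_phi hβ) (fun x => by simp only [hu.initial]; exact le_rfl)
  exact ⟨δ, hδ, h.mono fun t ht x => by linarith [ht x]⟩

/-- The `G`-heat flow started at `phi β_G` decays exponentially. -/
theorem abs_le_exp_of_phi_beta {G : GFunction} (hG : G.Nondegenerate) {u : ℝ × ℝ → ℝ}
    (hu : IsViscositySolution G (phi G.beta) u) {t : ℝ} (ht : 0 ≤ t) (x : ℝ) :
    |u (t, x)| ≤ 2 * Real.exp (-(rate G G.beta * t)) := by
  have hβ := GFunction.one_le_beta hG
  have hb : G.beta / G.beta = 1 := div_self (by linarith)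
  obtain ⟨C, hC⟩ := hu.bounded
  have h1 := IsSub.le_exp_mul (e := 1) (c := 0) G.elliptic hu.subsolution hu.continuousOn
    (fun t x ht => (abs_le.1 (hC t x ht)).2) (decaying_phi hG hβ) (rate_pos hG hβ).le
    (by rw [hb]; simp) (fun x => le_max_right _ _) one_pos
    (fun x => by rw [hu.initial]; linarith) ht (x := x)
  have h2 := IsSub.le_exp_mul (u := fun z => -u z) (C := C) (e := 1) (c := 0) G.elliptic.dual
    hu.supersolution.isSub_dual hu.continuousOn.neg
    (fun t x ht => by linarith [(abs_le.1 (hC t x ht)).1]) (decaying_neg_phi hG hβ)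
    (rate_pos hG hβ).le (by rw [hb]; simp) (fun x => le_max_right _ _) one_pos
    (fun x => by simp only [hu.initial]; linarith) ht (x := x)
  have h3 := abs_le.1 (abs_phi_le hβ x)
  have h4 := Real.exp_pos (-(rate G G.beta * t))
  rw [abs_le]
  constructor <;> nlinarith

/-! ### Separation of the two convolutions -/

theorem gConv_scaled {G G' : GFunction} (hG' : G'.Nondegenerate) {φ : ℝ → ℝ} {u : ℝ × ℝ → ℝ}
    (hu : IsViscositySolution G' φ u) {t : ℝ} (ht : 0 < t) :
    gConv G G' (fun x => φ (√t * x)) = gNormal G (fun x => u (t, √t * x)) := by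
  simp only [gConv, gNormal_scaled hG' hu ht]

theorem isBoundedLipschitz_slice {G : GFunction} {φ : ℝ → ℝ} {u : ℝ × ℝ → ℝ}
    (hu : IsViscositySolution G φ u) {L : ℝ} (hL : ∀ t x y, u (t, x) - u (t, y) ≤ L * |x - y|)
    {t : ℝ} (ht : 0 ≤ t) : IsBoundedLipschitz fun x => u (t, √t * x) := by
  obtain ⟨C, hC⟩ := hu.bounded
  have hL0 : 0 ≤ L := by
    have h1 := hL 0 0 1
    have h2 := hL 0 1 0
    simp at h1 h2; linarith
  refine ⟨⟨C, fun x => hC t _ ht⟩, (L * √t).toNNReal, LipschitzWith.of_dist_le_mul fun x y => ?_⟩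
  rw [Real.coe_toNNReal _ (by positivity), Real.dist_eq, Real.dist_eq]
  have e : L * |√t * x - √t * y| = L * √t * |x - y| := by
    rw [← mul_sub, abs_mul, abs_of_nonneg (Real.sqrt_nonneg t), mul_assoc]
  have h1 := hL t (√t * x) (√t * y)
  have h2 := hL t (√t * y) (√t * x)
  rw [abs_sub_comm] at h2
  rw [abs_le]; constructor <;> linarith

/-- The inner flow decides: with `G₁` inside the result is at most `2 exp(-μt)` in absolute value,
with `G₂` inside it stays beyond a fixed `±δ`, and the outer expectation preserves these bounds. -/
theorem eventually_gConv {G₁ G₂ : GFunction} (h₁ : G₁.Nondegenerate) (h₂ : G₂.Nondegenerate) :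
    (G₁.beta < G₂.beta → ∀ᶠ t : ℝ in atTop, gConv G₂ G₁ (fun x => phi G₁.beta (√t * x)) <
      gConv G₁ G₂ (fun x => phi G₁.beta (√t * x))) ∧
    (G₂.beta < G₁.beta → ∀ᶠ t : ℝ in atTop, gConv G₁ G₂ (fun x => phi G₁.beta (√t * x)) <
      gConv G₂ G₁ (fun x => phi G₁.beta (√t * x))) := by
  have hβ := GFunction.one_le_beta h₁
  obtain ⟨u, hu, L, hL⟩ := exists_isViscositySolution G₁ (isBoundedLipschitz_phi hβ)
  obtain ⟨v, hv, L', hL'⟩ := exists_isViscositySolution G₂ (isBoundedLipschitz_phi hβ)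
  have hlim : Tendsto (fun t : ℝ => 2 * Real.exp (-(rate G₁ G₁.beta * t))) atTop (𝓝 (2 * 0)) :=
    (Real.tendsto_exp_neg_atTop_nhds_zero.comp
      (tendsto_id.const_mul_atTop (rate_pos h₁ hβ))).const_mul 2
  rw [mul_zero] at hlim
  constructor
  · intro hlt
    obtain ⟨δ, hδ, hev⟩ := eventually_ge_of_lt_beta h₂ hβ hlt hv
    filter_upwards [hev, hlim.eventually (gt_mem_nhds hδ), eventually_gt_atTop 0] with t ht htδ ht0
    rw [gConv_scaled h₁ hu ht0, gConv_scaled h₂ hv ht0]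
    have a1 := gNormal_le h₂ (isBoundedLipschitz_slice hu hL ht0.le)
      fun x => (abs_le.1 (abs_le_exp_of_phi_beta h₁ hu ht0.le (√t * x))).2
    have a2 := le_gNormal h₁ (isBoundedLipschitz_slice hv hL' ht0.le) fun x => ht (√t * x)
    linarith
  · intro hlt
    obtain ⟨δ, hδ, hev⟩ := eventually_le_neg_of_beta_lt h₂ hβ hlt hv
    filter_upwards [hev, hlim.eventually (gt_mem_nhds hδ), eventually_gt_atTop 0] with t ht htδ ht0
    rw [gConv_scaled h₁ hu ht0, gConv_scaled h₂ hv ht0]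
    have a1 := le_gNormal h₂ (isBoundedLipschitz_slice hu hL ht0.le)
      fun x => (abs_le.1 (abs_le_exp_of_phi_beta h₁ hu ht0.le (√t * x))).1
    have a2 := gNormal_le h₁ (isBoundedLipschitz_slice hv hL' ht0.le) fun x => ht (√t * x)
    linarith

theorem eventually_gConv_ne {G₁ G₂ : GFunction} (h₁ : G₁.Nondegenerate) (h₂ : G₂.Nondegenerate)
    (hne : G₁.beta ≠ G₂.beta) : ∀ᶠ t : ℝ in atTop, gConv G₁ G₂ (fun x => phi G₁.beta (√t * x)) ≠
      gConv G₂ G₁ (fun x => phi G₁.beta (√t * x)) := by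
  rcases hne.lt_or_gt with h | h
  · exact ((eventually_gConv h₁ h₂).1 h).mono fun t ht => ht.ne'
  · exact ((eventually_gConv h₁ h₂).2 h).mono fun t ht => ht.ne

theorem exists_gConv_ne {G₁ G₂ : GFunction} (h₁ : G₁.Nondegenerate) (h₂ : G₂.Nondegenerate)
    (hne : G₁.beta ≠ G₂.beta) :
    ∃ φ, IsBoundedLipschitz φ ∧ gConv G₁ G₂ φ ≠ gConv G₂ G₁ φ := by
  obtain ⟨t, ht⟩ := (eventually_gConv_ne h₁ h₂ hne).exists
  obtain ⟨⟨C, hC⟩, K, hK⟩ := isBoundedLipschitz_phi (GFunction.one_le_beta h₁)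
  exact ⟨_, ⟨⟨C, fun x => hC _⟩, _, hK.comp (lipschitzWith_smul √t)⟩, ht⟩

end GNormal

theorem theorem2 :
    (∀ G₁ G₂ : GNormal.GFunction, G₁.Nondegenerate → G₂.Nondegenerate →
      ((∀ φ : ℝ → ℝ, GNormal.IsBoundedLipschitz φ →
          GNormal.gConv G₁ G₂ φ = GNormal.gConv G₂ G₁ φ) ↔ G₁.beta = G₂.beta) ∧
      (G₁.beta ≠ G₂.beta →
        ∀ᶠ t : ℝ in Filter.atTop,
          GNormal.gConv G₁ G₂ (fun x => GNormal.phi G₁.beta (Real.sqrt t * x)) ≠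
            GNormal.gConv G₂ G₁ (fun x => GNormal.phi G₁.beta (Real.sqrt t * x))) ∧
      (G₁.beta < G₂.beta →
        ∀ᶠ t : ℝ in Filter.atTop,
          GNormal.gConv G₂ G₁ (fun x => GNormal.phi G₁.beta (Real.sqrt t * x)) <
            GNormal.gConv G₁ G₂ (fun x => GNormal.phi G₁.beta (Real.sqrt t * x)))) ∧
    (∃ G₁ G₂ : GNormal.GFunction, G₁.Nondegenerate ∧ G₂.Nondegenerate ∧
      ∃ φ : ℝ → ℝ, GNormal.IsBoundedLipschitz φ ∧
        GNormal.gConv G₁ G₂ φ ≠ GNormal.gConv G₂ G₁ φ) := by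
  refine ⟨fun G₁ G₂ h₁ h₂ => ⟨⟨fun h => ?_, fun hβ φ hφ => GNormal.gConv_comm_of_beta_eq h₁ h₂ hβ hφ⟩,
    GNormal.eventually_gConv_ne h₁ h₂, (GNormal.eventually_gConv h₁ h₂).1⟩, ?_⟩
  · by_contra hne
    obtain ⟨φ, hφ, hφ'⟩ := GNormal.exists_gConv_ne h₁ h₂ hne
    exact hφ' (h φ hφ)
  · let G₁ : GNormal.GFunction := ⟨1, 1, zero_le_one, le_rfl⟩
    let G₂ : GNormal.GFunction := ⟨1, 2, zero_le_one, one_le_two⟩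
    have h₁ : G₁.Nondegenerate := one_pos
    have h₂ : G₂.Nondegenerate := one_pos
    exact ⟨G₁, G₂, h₁, h₂, GNormal.exists_gConv_ne h₁ h₂ (by simp [G₁, G₂, GNormal.GFunction.beta])⟩
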